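/- \textbf{Setting.} Let $(E_j,\mathcal E_j)$, $j=1,2,3$, be Borel spaces (measurably isomorphic to a Borel subset of $[0,1]$), with distinguished points $o_j\in E_j$. Put $E_j^o=E_j\setminus\{o_j\}$ and $E_{123}^o=(E_1\times E_2\times E_3)\setminus\{(o_1,o_2,o_3)\}$, with the trace $\sigma$-fields. For each $j$ let $L_{0,j}\subset L_{1,j}\subset\cdots$ be measurable sets with union $E_j^o$. Let $\Lambda$ be a measure on $E_{123}^o$ that is locally finite, i.e. for every $h$ it is finite on \[ (L_{h,1}\times E_2\times E_3)\cup(E_1\times L_{h,2}\times E_3)\cup(E_1\times E_2\times L_{h,3}), \] and suppose that $\Lambda(E_{123}^o)=\infty$ and \[ \Lambda(y_1=o_1,\,y_3=o_3)\in\{0,\infty\},\qquad \Lambda(y_2=o_2,\,y_3=o_3)\in\{0,\infty\},\qquad \Lambda(y_3=o_3)\in\{0,\infty\}. \] Let $\Lambda_3^o(A)=\Lambda(y_3\in A)$, for measurable $A\subset E_3^o$, and let $\Lambda_{12\mid 3^o}$ be a probability kernel from $E_3^o$ to $E_1\times E_2$ with \[ \Lambda(A)=\int_{E_3^o}\int \mathbf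 1_A(y_1,y_2,y_3)\,\Lambda_{12\mid 3^o}(dy_1dy_2\mid y_3)\,\Lambda_3^o(dy_3),\qquad A\in\mathcal E_1\otimes\mathcal E_2\otimes\mathcal E_3^o , \] with marginal kernels $\Lambda_{1\mid 3^o}=\Lambda_{12\mid 3^o}(\cdot\times E_2\mid\cdot)$ and $\Lambda_{2\mid 3^o}=\Lambda_{12\mid 3^o}(E_1\times\cdot\mid\cdot)$. Define a measure on $E_{123}^o$ by \[ \Lambda^\perp_{12;3}(A)=\Lambda\big(A\cap\{y_2=o_2,y_3=o_3\}\big)+\Lambda\big(A\cap\{y_1=o_1,y_3=o_3\}\big)+\Lambda_3^o\big(\{y_3:(o_1,o_2,y_3)\in A\}\big). \] A Poisson point process with mean measure $M$ is a random $\{0,1,\dots,\infty\}$-valued $s$-finite measure $N$ such that $N(A)$ is Poisson with mean $M(A)\in[0,\infty]$ for each measurable $A$, and such that $N(A_1),\dots,N(A_m)$ are independent for disjoint measurable $A_1,\dots,A_m$. Let $\xi$ be a Poisson point process on $E_{123}^o$ with mean measure $\Lambda$, and let $\xi_j(A)=\xi(y_j\in A)$, $A\in\mathcal E_j$, be its projections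 to the (non-punctured) spaces $E_j$. \textbf{Proposition.} The following are equivalent. (a) $\xi_1\perp\xi_2\mid\xi_3$. (b) For $\Lambda_3^o$-a.e. $y_3$ one has $\Lambda_{12\mid 3^o}(\cdot\mid y_3)=\Lambda_{1\mid 3^o}(\cdot\mid y_3)\otimes\Lambda_{2\mid 3^o}(\cdot\mid y_3)$, and moreover $\Lambda(y_1\ne o_1,\,y_2\ne o_2,\,y_3=o_3)=0$. (c) There exist measurable functions $h_j:E_3\times[0,1]\to E_j$ with $h_j(o_3,\cdot)\equiv o_j$, $j=1,2$, such that \[ \xi\ \overset{d}{=}\ \sum_{i\le\kappa}\delta_{\left(h_1(\eta_{i3},\theta_{i1})+\eta_{i1},\ h_2(\eta_{i3},\theta_{i2})+\eta_{i2},\ \eta_{i3}\right)} . \] Here $\sum_{i\le\kappa}\delta_{(\eta_{i1},\eta_{i2},\eta_{i3})}$, with a random number $\kappa\in\{0,1,\dots,\infty\}$ of random points, is an enumeration of a Poisson point process on $E_{123}^o$ with mean measure $\Lambda^\perp_{12;3}$ (so that $\kappa=\infty$ a.s. if $\Lambda^\perp_{12;3}$ has infinite total mass); $(\theta_{i1})_i$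 and $(\theta_{i2})_i$ are i.i.d. sequences, uniform on $[0,1]$, independent of each other and, jointly, of the enumeration $(\kappa,(\eta_i)_i)$; and $+$ is defined by $y_j+o_j=o_j+y_j=y_j$. The equivalence of (a) and (b) holds for every version of the kernel $\Lambda_{12\mid3^o}$, and the equivalence of (a) and (c) for every given enumeration $(\kappa,(\eta_i)_i)$ and sequences $(\theta_{i1})_i$, $(\theta_{i2})_i$ as described. -/

import Mathlib

open MeasureTheory ProbabilityTheory
open scoped ENNReal unitInterval

noncomputable section

namespace PoissonCI

universe u v w

/-! ### Point measures and Poisson processes -/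

section Poisson

variable {E : Type u} [MeasurableSpace E] {Ω : Type v} [MeasurableSpace Ω]

/-- A point measure: an s-finite measure with values in `{0, 1, 2, …, ∞}`. -/
def IsPointMeasure (ν : Measure E) : Prop :=
  SFinite ν ∧ ∀ A : Set E, MeasurableSet A → ∃ n : ℕ∞, ν A = (n : ℝ≥0∞)

/-- The Poisson distribution with mean `m ∈ [0, ∞]`, as a measure on `[0, ∞]`; mean `0` gives the
unit mass at `0` and mean `∞` the unit mass at `∞`. -/
def poissonLaw (m : ℝ≥0∞) : Measure ℝ≥0∞ :=
  if m = ∞ then Measure.dirac ∞ else (poissonMeasure m.toNNReal).map (fun n : ℕ => (n : ℝ≥0∞))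

/-- `N` is a Poisson point process with mean measure `Λ`, defined on the probability space
`(Ω, μ)`. The σ-algebra on `Measure E` is generated by the evaluations at measurable sets. -/
structure IsPoissonProcess (N : Ω → Measure E) (Λ : Measure E) (μ : Measure Ω) : Prop where
  measurable : Measurable N
  isPointMeasure : ∀ ω, IsPointMeasure (N ω)
  law_apply : ∀ A : Set E, MeasurableSet A → μ.map (fun ω => N ω A) = poissonLaw (Λ A)
  indep : ∀ (m : ℕ) (A : Fin m → Set E), (∀ i, MeasurableSet (A i)) →
    Pairwise (fun i j => Disjoint (A i) (A j)) → iIndepFun (fun i ω => N ω (A i)) μ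

/-- The point measure `∑_{i < κ} δ_{y i}`, for `κ ∈ {0, 1, …, ∞}`. -/
def pointSum (κ : ℕ∞) (y : ℕ → E) : Measure E :=
  Measure.sum fun i : ℕ => if (i : ℕ∞) < κ then Measure.dirac (y i) else 0

/-- The random number `κ` and the random points `η i` enumerate a Poisson point process
`∑_{i < κ} δ_{η i}` with mean measure `Λ`. -/
structure IsPoissonEnumeration (κ : Ω → ℕ∞) (η : ℕ → Ω → E) (Λ : Measure E) (μ : Measure Ω) :
    Prop where
  measurable_count : Measurable κ
  measurable_point : ∀ i, Measurable (η i)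
  isPoisson : IsPoissonProcess (fun ω => pointSum (κ ω) (fun i => η i ω)) Λ μ

/-- `θ` is a sequence of independent random variables, uniformly distributed on `[0, 1]`. -/
structure IsUniformSeq (θ : ℕ → Ω → I) (μ : Measure Ω) : Prop where
  measurable : ∀ i, Measurable (θ i)
  law : ∀ i, μ.map (θ i) = volume
  indep : iIndepFun θ μ

end Poisson

/-- Conditional independence of the random elements `X` and `Y` given the σ-algebra generated by
`Z`. (Mathlib's `CondIndepFun` is available over standard Borel probability spaces only.) -/
def CondIndep {Ω : Type u} [MeasurableSpace Ω] {S₁ S₂ S₃ : Type*} [MeasurableSpace S₁]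
    [MeasurableSpace S₂] [MeasurableSpace S₃] (X : Ω → S₁) (Y : Ω → S₂) (Z : Ω → S₃)
    (μ : Measure Ω) : Prop :=
  ∀ (A : Set S₁) (B : Set S₂), MeasurableSet A → MeasurableSet B →
    μ⟦X ⁻¹' A ∩ Y ⁻¹' B | MeasurableSpace.comap Z inferInstance⟧ =ᵐ[μ]
      μ⟦X ⁻¹' A | MeasurableSpace.comap Z inferInstance⟧ *
        μ⟦Y ⁻¹' B | MeasurableSpace.comap Z inferInstance⟧

/-! ### Punctured spaces -/

/-- The space `E` with the point `o` removed, with the trace σ-algebra. -/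
abbrev Punctured {E : Type u} (o : E) : Type u := {y : E // y ≠ o}

/-- The sets `L 0 ⊆ L 1 ⊆ ⋯` localize the punctured space `E \ {o}`. -/
structure IsLocalizing {E : Type u} [MeasurableSpace E] (o : E) (L : ℕ → Set E) : Prop where
  measurableSet : ∀ h, MeasurableSet (L h)
  mono : Monotone L
  iUnion_eq : ⋃ h, L h = {y | y ≠ o}

section Product

variable {E₁ : Type u} {E₂ : Type v} {E₃ : Type w} {o₁ : E₁} {o₂ : E₂} {o₃ : E₃}

/-- The localizing sequence
`(L₁ h × E₂ × E₃) ∪ (E₁ × L₂ h × E₃) ∪ (E₁ × E₂ × L₃ h)` of the punctured product space. -/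
def localizingProd (L₁ : ℕ → Set E₁) (L₂ : ℕ → Set E₂) (L₃ : ℕ → Set E₃) (h : ℕ) :
    Set (Punctured (o₁, o₂, o₃)) :=
  {y | y.1.1 ∈ L₁ h ∨ y.1.2.1 ∈ L₂ h ∨ y.1.2.2 ∈ L₃ h}

/-- The inclusion of `E₁ × E₂ × (E₃ \ {o₃})` into the punctured product space. -/
def inclThird (y : E₁ × E₂ × Punctured o₃) : Punctured (o₁, o₂, o₃) :=
  ⟨(y.1, y.2.1, y.2.2.1), fun h => y.2.2.2 (congrArg (fun z => z.2.2) h)⟩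

variable [MeasurableSpace E₁] [MeasurableSpace E₂] [MeasurableSpace E₃]

/-- The projection to `E₁` (not punctured) of a measure on the punctured product space. -/
def proj₁ (ν : Measure (Punctured (o₁, o₂, o₃))) : Measure E₁ := ν.map fun y => y.1.1

/-- The projection to `E₂` (not punctured) of a measure on the punctured product space. -/
def proj₂ (ν : Measure (Punctured (o₁, o₂, o₃))) : Measure E₂ := ν.map fun y => y.1.2.1

/-- The projection to `E₃` (not punctured) of a measure on the punctured product space. -/
def proj₃ (ν : Measure (Punctured (o₁, o₂, o₃))) : Measure E₃ := ν.map fun y => y.1.2.2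

/-- The third marginal measure, restricted to `E₃ \ {o₃}`. -/
def marginal₃ (Λ : Measure (Punctured (o₁, o₂, o₃))) : Measure (Punctured o₃) :=
  (proj₃ Λ).comap Subtype.val

/-- The restriction of a measure on the punctured product space to `E₁ × E₂ × (E₃ \ {o₃})`. -/
def restrictThird (Λ : Measure (Punctured (o₁, o₂, o₃))) : Measure (E₁ × E₂ × Punctured o₃) :=
  Λ.comap inclThird

/-- The kernel `K` is a version of the conditional kernel of the first two coordinates given the
third one, on the part of the space where the third coordinate is not `o₃`. -/
def IsDisintegration (Λ : Measure (Punctured (o₁, o₂, o₃)))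
    (K : Kernel (Punctured o₃) (E₁ × E₂)) : Prop :=
  IsMarkovKernel K ∧ ∀ A : Set (E₁ × E₂ × Punctured o₃), MeasurableSet A →
    restrictThird Λ A = ∫⁻ y₃, K y₃ {p | (p.1, p.2, y₃) ∈ A} ∂(marginal₃ Λ)

/-- The point `(o₁, o₂, y₃)` of the punctured product space. -/
def axis₃ (y₃ : Punctured o₃) : Punctured (o₁, o₂, o₃) := inclThird (o₁, o₂, y₃)

/-- The extremally independent mean measure: `Λ` restricted to the points `(y₁, o₂, o₃)`, plus `Λ`
restricted to the points `(o₁, y₂, o₃)`, plus the third punctured marginal of `Λ` carried over to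
the points `(o₁, o₂, y₃)`. -/
def extremalIndep (Λ : Measure (Punctured (o₁, o₂, o₃))) : Measure (Punctured (o₁, o₂, o₃)) :=
  Λ.restrict {y | y.1.2.1 = o₂ ∧ y.1.2.2 = o₃} + Λ.restrict {y | y.1.1 = o₁ ∧ y.1.2.2 = o₃} +
    (marginal₃ Λ).map axis₃

open Classical in
/-- The partial addition for which `o` is neutral: `x + o = o + x = x`. The value at two points that
both differ from `o` is immaterial. -/
def padd {E : Type u} (o x y : E) : E := if x = o then y else x

/-- The point `(h₁(y₃, s) + y₁, h₂(y₃, t) + y₂, y₃)` for a point `y` of the punctured product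
space; it is again in the punctured product space because `h₁` and `h₂` vanish at `o₃`. -/
def representPoint (h₁ : E₃ × I → E₁) (h₂ : E₃ × I → E₂) (hh₁ : ∀ s, h₁ (o₃, s) = o₁)
    (hh₂ : ∀ t, h₂ (o₃, t) = o₂) (y : Punctured (o₁, o₂, o₃)) (s t : I) :
    Punctured (o₁, o₂, o₃) :=
  ⟨(padd o₁ (h₁ (y.1.2.2, s)) y.1.1, padd o₂ (h₂ (y.1.2.2, t)) y.1.2.1, y.1.2.2), by
    intro h
    have h3 : y.1.2.2 = o₃ := congrArg (fun z => z.2.2) h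
    have h1 := congrArg (fun z => z.1) h
    have h2 := congrArg (fun z => z.2.1) h
    simp only [h3, hh₁, hh₂, padd, if_true] at h1 h2
    exact y.2 (Prod.ext h1 (Prod.ext h2 h3))⟩

end Product

end PoissonCI

end

/-!
The law of a Poisson process is determined by its Laplace functional
`f ↦ exp (-∫ (1 - exp (-f)) dΛ)`, and so is the conditional law of `(ξ₁, ξ₂)` given `ξ₃`. Because
`Λ {y₃ = o₃}` is `0` or `∞`, the conditional Laplace functional given `ξ₃` is the exponential of
minus the sum of a deterministic exponent from the points with `y₃ = o₃` and the integral with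
respect to `ξ₃` of an exponent formed with the disintegration kernel. Conditional independence
means that both exponents are additive in the test functions on `E₁` and `E₂`. For void
probabilities, additivity of the second exponent is the factorization of the kernel, and additivity
of the first one says that no mass of `{y₃ = o₃}` lies off the two axes. By the marking
theorem, the point process in (c) is Poisson with a mean measure whose conditional kernel is a
product and which has no mass off the axes on `{y₃ = o₃}`, and two Poisson processes have
the same law if and only if their mean measures agree.
-/

namespace PoissonCI

/-! ### The exponential `x ↦ exp (-x)` on `[0, ∞]` -/

/-- The function `x ↦ exp (-x)` on `[0, ∞]`, with `exp (-∞) = 0`. -/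
noncomputable def expNeg (x : ℝ≥0∞) : ℝ≥0∞ := EReal.exp (-(x : EReal))

/-- The inverse `[0, 1] → [0, ∞]` of `expNeg`, extended by `0` to arguments above `1`. -/
noncomputable def negLog (x : ℝ≥0∞) : ℝ≥0∞ := (-(ENNReal.log x)).toENNReal

@[simp] lemma expNeg_zero : expNeg 0 = 1 := by simp [expNeg]

@[simp] lemma expNeg_top : expNeg ∞ = 0 := by simp [expNeg]

lemma expNeg_add (x y : ℝ≥0∞) : expNeg (x + y) = expNeg x * expNeg y := by
  rw [expNeg, EReal.coe_ennreal_add, EReal.neg_add (by simp) (by simp), sub_eq_add_neg,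
    EReal.exp_add, ← expNeg, ← expNeg]

lemma expNeg_strictAnti : StrictAnti expNeg := fun x y h => by simpa [expNeg] using h

lemma expNeg_injective : Function.Injective expNeg := expNeg_strictAnti.injective

lemma expNeg_le_one (x : ℝ≥0∞) : expNeg x ≤ 1 :=
  expNeg_zero ▸ expNeg_strictAnti.antitone (zero_le (a := x))

lemma expNeg_ne_top (x : ℝ≥0∞) : expNeg x ≠ ∞ :=
  ne_top_of_le_ne_top ENNReal.one_ne_top (expNeg_le_one x)

lemma expNeg_eq_one_iff {x : ℝ≥0∞} : expNeg x = 1 ↔ x = 0 := by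
  rw [← expNeg_zero, expNeg_injective.eq_iff]

lemma one_sub_expNeg_eq_zero_iff {x : ℝ≥0∞} : 1 - expNeg x = 0 ↔ x = 0 := by
  rw [tsub_eq_zero_iff_le, (expNeg_le_one x).ge_iff_eq, expNeg_eq_one_iff]

lemma continuous_expNeg : Continuous expNeg :=
  ENNReal.continuous_exp.comp (continuous_neg.comp continuous_coe_ennreal_ereal)

@[fun_prop] lemma measurable_expNeg : Measurable expNeg := continuous_expNeg.measurable

@[fun_prop] lemma measurable_negLog : Measurable negLog :=
  ENNReal.measurable_log.neg.ereal_toENNReal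

lemma expNeg_negLog {x : ℝ≥0∞} (hx : x ≤ 1) : expNeg (negLog x) = x := by
  have hlog : 0 ≤ -(ENNReal.log x) := by
    rw [EReal.le_neg]
    simpa using hx
  rw [expNeg, negLog, EReal.coe_toENNReal hlog, neg_neg, ENNReal.exp_log]

lemma negLog_expNeg (x : ℝ≥0∞) : negLog (expNeg x) = x :=
  expNeg_injective (expNeg_negLog (expNeg_le_one x))

lemma expNeg_sum {ι : Type*} (s : Finset ι) (f : ι → ℝ≥0∞) :
    expNeg (∑ i ∈ s, f i) = ∏ i ∈ s, expNeg (f i) := by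
  induction s using Finset.cons_induction with
  | empty => simp
  | cons a s ha ih => rw [Finset.sum_cons, Finset.prod_cons, expNeg_add, ih]

lemma expNeg_nat_mul (n : ℕ) (x : ℝ≥0∞) : expNeg (n * x) = expNeg x ^ n := by
  simpa using expNeg_sum (Finset.range n) fun _ => x

lemma expNeg_ofReal {x : ℝ} (hx : 0 ≤ x) :
    expNeg (ENNReal.ofReal x) = ENNReal.ofReal (Real.exp (-x)) := by
  rw [expNeg, EReal.coe_ennreal_ofReal, max_eq_left hx, ← EReal.coe_neg, EReal.exp_coe]

lemma expNeg_top_mul (x : ℝ≥0∞) : expNeg (∞ * x) = if x = 0 then 1 else 0 := by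
  split_ifs with h
  · simp [h]
  · simp [ENNReal.top_mul h]

/-! ### Finite measures are determined by exponential moments -/

section Uniqueness

/-- The algebra of polynomial functions on the cube `[0, 1]^ι`. -/
noncomputable def cubePolynomials (ι : Type*) [Fintype ι] :
    StarSubalgebra ℝ (BoundedContinuousFunction (ι → I) ℝ) where
  toSubalgebra := (MvPolynomial.aeval fun i =>
    BoundedContinuousFunction.mkOfCompact ⟨fun x : ι → I => (x i : ℝ), by fun_prop⟩).range
  star_mem' {a} ha := by
    rwa [show star a = a by ext x; simp]

lemma exists_eq_sum_of_mem_cubePolynomials {ι : Type*} [Fintype ι]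
    {g : BoundedContinuousFunction (ι → I) ℝ} (hg : g ∈ cubePolynomials ι) :
    ∃ p : MvPolynomial ι ℝ, ∀ x, g x = ∑ n ∈ p.support, p.coeff n * ∏ i, (x i : ℝ) ^ n i := by
  obtain ⟨p, rfl⟩ := hg
  refine ⟨p, fun x => ?_⟩
  simp [MvPolynomial.aeval_def, MvPolynomial.eval₂_eq']

lemma ext_of_integral_monomial {ι : Type*} [Fintype ι] {P Q : Measure (ι → I)}
    [IsFiniteMeasure P] [IsFiniteMeasure Q]
    (h : ∀ n : ι → ℕ, ∫ x, ∏ i, (x i : ℝ) ^ n i ∂P = ∫ x, ∏ i, (x i : ℝ) ^ n i ∂Q) : P = Q := by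
  refine ext_of_forall_mem_subalgebra_integral_eq_of_polish (𝕜 := ℝ) (A := cubePolynomials ι)
    ?_ fun g hg => ?_
  · intro x y hxy
    obtain ⟨i, hi⟩ := Function.ne_iff.1 hxy
    refine ⟨_, ⟨_, ⟨_, ⟨MvPolynomial.X i, rfl⟩, rfl⟩, rfl⟩, ?_⟩
    simpa [Subtype.ext_iff] using hi
  · obtain ⟨p, hp⟩ := exists_eq_sum_of_mem_cubePolynomials hg
    have hint (n : ι →₀ ℕ) (R : Measure (ι → I)) [IsFiniteMeasure R] :
        Integrable (fun x => p.coeff n * ∏ i, (x i : ℝ) ^ n i) R :=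
      (Continuous.integrable_of_hasCompactSupport (by fun_prop)
        (HasCompactSupport.of_compactSpace _))
    simp_rw [hp]
    rw [integral_finsetSum _ fun n _ => hint n P, integral_finsetSum _ fun n _ => hint n Q]
    simp_rw [integral_const_mul, h]

variable {S : Type*} [MeasurableSpace S]

/-- The map `s ↦ (exp (-f i s))ᵢ` into a cube, through which exponential moments become moments. -/
noncomputable def expNegVec {ι : Type*} (f : ι → S → ℝ≥0∞) (s : S) : ι → I := fun i =>
  ⟨(expNeg (f i s)).toReal, ENNReal.toReal_nonneg,
    ENNReal.toReal_le_of_le_ofReal zero_le_one (by simpa using expNeg_le_one _)⟩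

lemma measurable_expNegVec {ι : Type*} {f : ι → S → ℝ≥0∞} (hf : ∀ i, Measurable (f i)) :
    Measurable (expNegVec f) :=
  measurable_pi_lambda _ fun i => Measurable.subtype_mk (by fun_prop)

lemma map_expNegVec_eq {P Q : Measure S} [IsFiniteMeasure P] [IsFiniteMeasure Q]
    {ι : Type*} [Fintype ι] {f : ι → S → ℝ≥0∞} (hf : ∀ i, Measurable (f i))
    (h : ∀ n : ι → ℕ, ∫⁻ s, expNeg (∑ i, n i * f i s) ∂P = ∫⁻ s, expNeg (∑ i, n i * f i s) ∂Q) :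
    P.map (expNegVec f) = Q.map (expNegVec f) := by
  have hm := measurable_expNegVec hf
  have hmoment (ν : Measure S) (n : ι → ℕ) : ∫ x, ∏ i, (x i : ℝ) ^ n i ∂(ν.map (expNegVec f)) =
      (∫⁻ s, expNeg (∑ i, n i * f i s) ∂ν).toReal := by
    rw [integral_map hm.aemeasurable (Continuous.aestronglyMeasurable (by fun_prop)),
      ← integral_toReal (Measurable.aemeasurable (by fun_prop))
        (ae_of_all _ fun s => (expNeg_ne_top _).lt_top)]
    simp [expNegVec, expNeg_sum, expNeg_nat_mul, ENNReal.toReal_prod]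
  refine ext_of_integral_monomial fun n => ?_
  rw [hmoment, hmoment, h]

theorem ext_of_lintegral_expNeg {P Q : Measure S} [IsFiniteMeasure P] [IsFiniteMeasure Q]
    (T : AddSubmonoid (S → ℝ≥0∞)) (hT : ∀ f ∈ T, Measurable f)
    (hgen : (inferInstance : MeasurableSpace S) ≤ ⨆ f ∈ T, MeasurableSpace.comap f inferInstance)
    (h : ∀ f ∈ T, ∫⁻ s, expNeg (f s) ∂P = ∫⁻ s, expNeg (f s) ∂Q) : P = Q := by
  have hgen' : (inferInstance : MeasurableSpace S) =
      ⨆ f ∈ (T : Set (S → ℝ≥0∞)), MeasurableSpace.comap f inferInstance :=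
    le_antisymm hgen (iSup₂_le fun f hf => (hT f hf).comap_le)
  rw [← generateFrom_piiUnionInter_measurableSet] at hgen'
  refine ext_of_generate_finite _ hgen'
    (isPiSystem_piiUnionInter _ (fun f => @MeasurableSpace.isPiSystem_measurableSet _
      (MeasurableSpace.comap f inferInstance)) _) ?_ (by simpa using h 0 T.zero_mem)
  rintro _ ⟨t, htT, B, hB, rfl⟩
  choose! C hC hCB using hB
  have htm (f : t) : Measurable f.1 := hT f (htT f.2)
  have hset : ⋂ f ∈ t, B f = expNegVec (fun f : t => f.1) ⁻¹'
      (⋂ f : t, {x | negLog (ENNReal.ofReal (x f)) ∈ C f.1}) := by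
    ext s
    simp only [Set.mem_iInter, Set.mem_preimage, Set.mem_ofPred_eq, Subtype.forall]
    refine forall₂_congr fun f hf => ?_
    rw [← hCB f hf]
    simp [expNegVec, ENNReal.ofReal_toReal (expNeg_ne_top _), negLog_expNeg]
  have hmeas : MeasurableSet (⋂ f : t, {x : t → I | negLog (ENNReal.ofReal (x f)) ∈ C f.1}) :=
    .iInter fun f => measurableSet_preimage (by fun_prop) (hC f.1 f.2)
  have hmoments (n : t → ℕ) : ∑ f, n f • f.1 ∈ T := sum_mem fun f _ => nsmul_mem (htT f.2) _
  have hmap : P.map (expNegVec fun f : t => f.1) = Q.map (expNegVec fun f : t => f.1) :=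
    map_expNegVec_eq htm fun n => by simpa using h _ (hmoments n)
  rw [hset, ← Measure.map_apply (measurable_expNegVec htm) hmeas,
    ← Measure.map_apply (measurable_expNegVec htm) hmeas, hmap]

end Uniqueness

/-! ### Laplace functionals -/

section Laplace

variable {E : Type*} [MeasurableSpace E] {Ω : Type*} [MeasurableSpace Ω]
  {μ : Measure Ω} {ζ : Ω → Measure E} {M : Measure E}

@[fun_prop]
lemma measurable_lintegral_measure (hζ : Measurable ζ) {f : E → ℝ≥0∞} (hf : Measurable f) :
    Measurable fun ω => ∫⁻ y, f y ∂(ζ ω) :=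
  (Measure.measurable_lintegral hf).comp hζ

/-- The additive class of functionals `ν ↦ ∫ f dν` on the space of measures. -/
def lintegralFunctionals (E : Type*) [MeasurableSpace E] : AddSubmonoid (Measure E → ℝ≥0∞) where
  carrier := {φ | ∃ f : E → ℝ≥0∞, Measurable f ∧ φ = fun ν => ∫⁻ y, f y ∂ν}
  zero_mem' := ⟨0, measurable_zero, by ext; simp⟩
  add_mem' := by
    rintro _ _ ⟨f, hf, rfl⟩ ⟨g, hg, rfl⟩
    exact ⟨f + g, hf.add hg, by ext ν; simp [lintegral_add_left hf]⟩

theorem ext_of_laplace {P Q : Measure (Measure E)} [IsFiniteMeasure P] [IsFiniteMeasure Q]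
    (h : ∀ f : E → ℝ≥0∞, Measurable f →
      ∫⁻ ν, expNeg (∫⁻ y, f y ∂ν) ∂P = ∫⁻ ν, expNeg (∫⁻ y, f y ∂ν) ∂Q) : P = Q := by
  refine ext_of_lintegral_expNeg (lintegralFunctionals E) ?_ ?_ ?_
  · rintro _ ⟨f, hf, rfl⟩
    exact Measure.measurable_lintegral hf
  · refine iSup₂_le fun A hA => le_iSup₂_of_le (fun ν => ν A) ?_ le_rfl
    exact ⟨A.indicator 1, measurable_one.indicator hA, by ext ν; simp [lintegral_indicator_one hA]⟩
  · rintro _ ⟨f, hf, rfl⟩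
    exact h f hf

lemma expNeg_lintegral_indicator_top {D : Set E} (hD : MeasurableSet D) (ν : Measure E) :
    expNeg (∫⁻ y, D.indicator (fun _ => ∞) y ∂ν) = {ν' : Measure E | ν' D = 0}.indicator 1 ν := by
  simp [lintegral_indicator_const hD, expNeg_top_mul, Set.indicator_apply]

lemma lintegral_one_sub_expNeg_add_indicator_top (M : Measure E) {g : E → ℝ≥0∞}
    {C : Set E} (hC : MeasurableSet C) :
    ∫⁻ y, (1 - expNeg (g y + C.indicator (fun _ => ∞) y)) ∂M =
      M C + ∫⁻ y in Cᶜ, (1 - expNeg (g y)) ∂M := by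
  rw [← lintegral_add_compl _ hC, setLIntegral_congr_fun (g := 1) hC fun y hy => by simp [hy],
    setLIntegral_congr_fun (g := fun y => 1 - expNeg (g y)) hC.compl fun y hy => by
      simp [Set.indicator_of_notMem hy]]
  simp

lemma lintegral_one_sub_expNeg_indicator_top (M : Measure E) {C : Set E} (hC : MeasurableSet C) :
    ∫⁻ y, (1 - expNeg (C.indicator (fun _ => ∞) y)) ∂M = M C := by
  simpa using lintegral_one_sub_expNeg_add_indicator_top M (g := 0) hC

/-- The random measure `ζ` has the Laplace functional of a Poisson process with mean measure `M`,
which determines its law. Unlike `IsPoissonProcess`, this constrains the law of `ζ` only. -/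
structure HasPoissonLaplace (ζ : Ω → Measure E) (M : Measure E) (μ : Measure Ω) : Prop where
  measurable : Measurable ζ
  laplace {f : E → ℝ≥0∞} : Measurable f →
    ∫⁻ ω, expNeg (∫⁻ y, f y ∂(ζ ω)) ∂μ = expNeg (∫⁻ y, (1 - expNeg (f y)) ∂M)

namespace HasPoissonLaplace

lemma isProbabilityMeasure (hζ : HasPoissonLaplace ζ M μ) : IsProbabilityMeasure μ :=
  ⟨by simpa using hζ.laplace measurable_zero⟩

lemma map {F : Type*} [MeasurableSpace F] (hζ : HasPoissonLaplace ζ M μ) {g : E → F}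
    (hg : Measurable g) : HasPoissonLaplace (fun ω => (ζ ω).map g) (M.map g) μ where
  measurable := (Measure.measurable_map g hg).comp hζ.measurable
  laplace {f} hf := by
    simp_rw [lintegral_map hf hg]
    rw [lintegral_map (by fun_prop) hg]
    exact hζ.laplace (hf.comp hg)

theorem identDistrib_iff {Ω' : Type*} [MeasurableSpace Ω'] {μ' : Measure Ω'}
    {ζ' : Ω' → Measure E} {M' : Measure E} (hζ : HasPoissonLaplace ζ M μ)
    (hζ' : HasPoissonLaplace ζ' M' μ') : IdentDistrib ζ ζ' μ μ' ↔ M = M' := by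
  have := hζ.isProbabilityMeasure
  have := hζ'.isProbabilityMeasure
  constructor
  · intro h
    ext A hA
    have hlaplace := (h.comp (u := fun ν => expNeg (∫⁻ y, A.indicator (fun _ => ∞) y ∂ν))
      (by fun_prop (disch := measurability))).lintegral_eq
    simp only [Function.comp_def] at hlaplace
    rw [hζ.laplace (measurable_const.indicator hA), hζ'.laplace (measurable_const.indicator hA),
      lintegral_one_sub_expNeg_indicator_top M hA,
      lintegral_one_sub_expNeg_indicator_top M' hA] at hlaplace
    exact expNeg_injective hlaplace
  · rintro rfl
    refine ⟨hζ.measurable.aemeasurable, hζ'.measurable.aemeasurable, ?_⟩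
    have := Measure.isProbabilityMeasure_map (μ := μ) hζ.measurable.aemeasurable
    have := Measure.isProbabilityMeasure_map (μ := μ') hζ'.measurable.aemeasurable
    refine ext_of_laplace fun f hf => ?_
    rw [lintegral_map (by fun_prop) hζ.measurable, lintegral_map (by fun_prop) hζ'.measurable,
      hζ.laplace hf, hζ'.laplace hf]

lemma add_lintegral_eq_of_ae_eq (hζ : HasPoissonLaplace ζ M μ) {g g' f : E → ℝ≥0∞}
    (hg : Measurable g) (hg' : Measurable g') (hf : Measurable f) {α β : ℝ≥0∞}
    (h : ∀ᵐ ω ∂μ, α + ∫⁻ y, g y ∂(ζ ω) = β + ∫⁻ y, g' y ∂(ζ ω)) :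
    α + ∫⁻ y, (1 - expNeg (g y + f y)) ∂M = β + ∫⁻ y, (1 - expNeg (g' y + f y)) ∂M := by
  have hζm := hζ.measurable
  have hlaplace := hζ.laplace (f := fun y => g y + f y) (by fun_prop)
  have hlaplace' := hζ.laplace (f := fun y => g' y + f y) (by fun_prop)
  refine expNeg_injective ?_
  rw [expNeg_add, expNeg_add, ← hlaplace, ← hlaplace', ← lintegral_const_mul _ (by fun_prop),
    ← lintegral_const_mul _ (by fun_prop)]
  refine lintegral_congr_ae (h.mono fun ω hω => ?_)
  simp only [← expNeg_add]
  rw [lintegral_add_left hg, lintegral_add_left hg', ← add_assoc, hω, add_assoc]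

/-- The exponential functional is compared on the events that `ζ` has no point in a set `C` of
finite mean, which makes the integral of `1 - exp (-g)` over `C` visible. -/
theorem eq_and_ae_eq_of_add_lintegral_ae_eq (hζ : HasPoissonLaplace ζ M μ) {g g' : E → ℝ≥0∞}
    (hg : Measurable g) (hg' : Measurable g') (hg_fin : ∫⁻ y, (1 - expNeg (g y)) ∂M ≠ ∞)
    (hg'_fin : ∫⁻ y, (1 - expNeg (g' y)) ∂M ≠ ∞) {α β : ℝ≥0∞} (hβ : β ≠ ∞)
    (h : ∀ᵐ ω ∂μ, α + ∫⁻ y, g y ∂(ζ ω) = β + ∫⁻ y, g' y ∂(ζ ω)) :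
    α = β ∧ g =ᵐ[M] g' := by
  have htotal : α + ∫⁻ y, (1 - expNeg (g y)) ∂M = β + ∫⁻ y, (1 - expNeg (g' y)) ∂M := by
    simpa using hζ.add_lintegral_eq_of_ae_eq hg hg' measurable_zero h
  have hcompl {C : Set E} (hC : MeasurableSet C) (hC_fin : M C < ∞) :
      α + ∫⁻ y in Cᶜ, (1 - expNeg (g y)) ∂M = β + ∫⁻ y in Cᶜ, (1 - expNeg (g' y)) ∂M := by
    have hvoid := hζ.add_lintegral_eq_of_ae_eq hg hg' (f := C.indicator fun _ => ∞)
      (measurable_const.indicator hC) h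
    rw [lintegral_one_sub_expNeg_add_indicator_top M hC,
      lintegral_one_sub_expNeg_add_indicator_top M hC, add_left_comm, add_left_comm β] at hvoid
    exact (ENNReal.add_right_inj hC_fin.ne).1 hvoid
  have hset {C : Set E} (hC : MeasurableSet C) (hC_fin : M C < ∞) :
      ∫⁻ y in C, (1 - expNeg (g y)) ∂M = ∫⁻ y in C, (1 - expNeg (g' y)) ∂M := by
    rw [← lintegral_add_compl _ hC, ← lintegral_add_compl (fun y => 1 - expNeg (g' y)) hC,
      add_left_comm, add_left_comm β, hcompl hC hC_fin] at htotal
    refine (ENNReal.add_left_inj (ENNReal.add_ne_top.2 ⟨hβ, ?_⟩)).1 htotal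
    exact ne_top_of_le_ne_top hg'_fin (setLIntegral_le_lintegral _ _)
  have hae : (fun y => 1 - expNeg (g y)) =ᵐ[M] fun y => 1 - expNeg (g' y) :=
    AEMeasurable.ae_eq_of_forall_setLIntegral_eq (by fun_prop) (by fun_prop) hg_fin hg'_fin
      fun C hC hC_fin => hset hC hC_fin
  constructor
  · rw [lintegral_congr_ae hae] at htotal
    exact (ENNReal.add_left_inj hg'_fin).1 htotal
  · filter_upwards [hae] with y hy
    refine expNeg_injective ?_
    rw [← ENNReal.sub_sub_cancel ENNReal.one_ne_top (expNeg_le_one (g y)), hy,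
      ENNReal.sub_sub_cancel ENNReal.one_ne_top (expNeg_le_one (g' y))]

end HasPoissonLaplace

/-! ### The Laplace functional of a Poisson process -/

lemma lintegral_pow_poissonMeasure (r : NNReal) {q : ℝ≥0∞} (hq : q ≤ 1) :
    ∫⁻ n, q ^ n ∂(poissonMeasure r) = expNeg (r * (1 - q)) := by
  lift q to NNReal using ne_top_of_le_ne_top ENNReal.one_ne_top hq
  have hq' : (q : ℝ) ≤ 1 := by exact_mod_cast hq
  have hsum : HasSum (fun n : ℕ => Real.exp (-r) * r ^ n / (n.factorial : ℝ) * q ^ n)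
      (Real.exp (-(r * (1 - q)))) := by
    have hexp := (NormedSpace.expSeries_div_hasSum_exp ((r : ℝ) * q)).mul_left (Real.exp (-r))
    rw [← Real.exp_eq_exp_ℝ, ← Real.exp_add] at hexp
    rw [show -((r : ℝ) * (1 - q)) = -r + r * q by ring]
    refine hexp.congr_fun fun n => ?_
    rw [mul_pow]
    ring
  have hmean : (r : ℝ≥0∞) * (1 - q) = ENNReal.ofReal (r * (1 - q)) := by
    rw [ENNReal.ofReal_mul r.coe_nonneg, ENNReal.ofReal_sub _ q.coe_nonneg]
    simp
  rw [hmean, expNeg_ofReal (mul_nonneg r.coe_nonneg (sub_nonneg.2 hq')), ← hsum.tsum_eq,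
    ENNReal.ofReal_tsum_of_nonneg (fun n => by positivity) hsum.summable, poissonMeasure,
    lintegral_sum_measure]
  refine tsum_congr fun n => ?_
  rw [lintegral_smul_measure, lintegral_dirac, smul_eq_mul, ENNReal.ofReal_mul (by positivity),
    ENNReal.ofReal_pow q.coe_nonneg, ENNReal.ofReal_coe_nnreal]

lemma lintegral_expNeg_mul_poissonLaw (m c : ℝ≥0∞) :
    ∫⁻ x, expNeg (c * x) ∂(poissonLaw m) = expNeg (m * (1 - expNeg c)) := by
  unfold poissonLaw
  split_ifs with hm
  · rw [lintegral_dirac' _ (by fun_prop), hm, mul_comm c, expNeg_top_mul, expNeg_top_mul]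
    simp only [one_sub_expNeg_eq_zero_iff]
  · rw [lintegral_map (by fun_prop) .of_discrete]
    simp_rw [mul_comm c, expNeg_nat_mul]
    rw [lintegral_pow_poissonMeasure _ (expNeg_le_one c), ENNReal.coe_toNNReal hm]

namespace IsPoissonProcess

variable {ξ : Ω → Measure E} {Λ : Measure E}

lemma iIndepFun_apply (hξ : IsPoissonProcess ξ Λ μ) {ι : Type*} [Finite ι] {A : ι → Set E}
    (hA : ∀ i, MeasurableSet (A i)) (hdisj : Pairwise fun i j => Disjoint (A i) (A j)) :
    iIndepFun (fun i ω => ξ ω (A i)) μ := by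
  have := Fintype.ofFinite ι
  have hfin := hξ.indep (Fintype.card ι) (fun i => A ((Fintype.equivFin ι).symm i))
    (fun i => hA _) (hdisj.comp_of_injective (Fintype.equivFin ι).symm.injective)
  simpa using hfin.precomp (Fintype.equivFin ι).injective

lemma lintegral_expNeg_mul (hξ : IsPoissonProcess ξ Λ μ) {A : Set E} (hA : MeasurableSet A)
    (c : ℝ≥0∞) : ∫⁻ ω, expNeg (c * ξ ω A) ∂μ = expNeg (Λ A * (1 - expNeg c)) := by
  have hmeas : Measurable fun ω => ξ ω A := (Measure.measurable_coe hA).comp hξ.measurable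
  rw [← lintegral_expNeg_mul_poissonLaw, ← hξ.law_apply A hA, lintegral_map (by fun_prop) hmeas]

lemma laplace_simpleFunc (hξ : IsPoissonProcess ξ Λ μ) (f : SimpleFunc E ℝ≥0∞) :
    ∫⁻ ω, expNeg (∫⁻ y, f y ∂(ξ ω)) ∂μ = expNeg (∫⁻ y, (1 - expNeg (f y)) ∂Λ) := by
  have hmeas (c : f.range) : Measurable fun ω => ξ ω (f ⁻¹' {c.1}) :=
    (Measure.measurable_coe (f.measurableSet_fiber _)).comp hξ.measurable
  have hmean : ∫⁻ y, (1 - expNeg (f y)) ∂Λ =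
      ∑ c : f.range, Λ (f ⁻¹' {c.1}) * (1 - expNeg c.1) := by
    have hmap := SimpleFunc.lintegral_eq_lintegral (f.map fun c => 1 - expNeg c) Λ
    rw [SimpleFunc.map_lintegral, ← Finset.sum_coe_sort] at hmap
    simpa [mul_comm] using hmap
  have hindep : iIndepFun (fun (c : f.range) ω => expNeg (c.1 * ξ ω (f ⁻¹' {c.1}))) μ :=
    (hξ.iIndepFun_apply (fun c => f.measurableSet_fiber _) fun c d hcd =>
      Disjoint.preimage _ (Set.disjoint_singleton.2 (Subtype.coe_ne_coe.2 hcd))).comp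
      (fun c x => expNeg (c.1 * x)) fun c => by fun_prop
  calc ∫⁻ ω, expNeg (∫⁻ y, f y ∂(ξ ω)) ∂μ
      = ∫⁻ ω, ∏ c : f.range, expNeg (c.1 * ξ ω (f ⁻¹' {c.1})) ∂μ := by
        refine lintegral_congr fun ω => ?_
        rw [SimpleFunc.lintegral_eq_lintegral, SimpleFunc.lintegral, ← Finset.sum_coe_sort,
          expNeg_sum]
    _ = ∏ c : f.range, ∫⁻ ω, expNeg (c.1 * ξ ω (f ⁻¹' {c.1})) ∂μ :=
        lintegral_prod_eq_prod_lintegral_of_indepFun _ _ hindep fun c => by fun_prop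
    _ = ∏ c : f.range, expNeg (Λ (f ⁻¹' {c.1}) * (1 - expNeg c.1)) :=
        Finset.prod_congr rfl fun c _ => hξ.lintegral_expNeg_mul (f.measurableSet_fiber _) _
    _ = expNeg (∫⁻ y, (1 - expNeg (f y)) ∂Λ) := by rw [hmean, expNeg_sum]

theorem hasPoissonLaplace [IsFiniteMeasure μ] (hξ : IsPoissonProcess ξ Λ μ) :
    HasPoissonLaplace ξ Λ μ := by
  refine ⟨hξ.measurable, fun {f} hf => ?_⟩
  have hξm := hξ.measurable
  have hfm (n : ℕ) := (SimpleFunc.eapprox f n).measurable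
  have hlim (y : E) := SimpleFunc.tendsto_eapprox hf y
  have hmono (y : E) : Monotone fun n => SimpleFunc.eapprox f n y :=
    fun _ _ hmn => SimpleFunc.monotone_eapprox f hmn y
  have hlaplace : Filter.Tendsto
      (fun n => ∫⁻ ω, expNeg (∫⁻ y, SimpleFunc.eapprox f n y ∂(ξ ω)) ∂μ)
      Filter.atTop (nhds (∫⁻ ω, expNeg (∫⁻ y, f y ∂(ξ ω)) ∂μ)) :=
    tendsto_lintegral_of_dominated_convergence (fun _ => 1) (fun n => by fun_prop)
      (fun n => ae_of_all _ fun ω => expNeg_le_one _) (by simp) (ae_of_all _ fun ω =>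
        (continuous_expNeg.tendsto _).comp (lintegral_tendsto_of_tendsto_of_monotone
          (fun n => (hfm n).aemeasurable) (ae_of_all _ hmono) (ae_of_all _ hlim)))
  have hexponent : Filter.Tendsto
      (fun n => expNeg (∫⁻ y, (1 - expNeg (SimpleFunc.eapprox f n y)) ∂Λ))
      Filter.atTop (nhds (expNeg (∫⁻ y, (1 - expNeg (f y)) ∂Λ))) :=
    (continuous_expNeg.tendsto _).comp (lintegral_tendsto_of_tendsto_of_monotone
      (fun n => Measurable.aemeasurable (by fun_prop))
      (ae_of_all _ fun y _ _ hmn => tsub_le_tsub_left (expNeg_strictAnti.antitone (hmono y hmn)) 1)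
      (ae_of_all _ fun y => ENNReal.Tendsto.sub tendsto_const_nhds
        ((continuous_expNeg.tendsto _).comp (hlim y)) (Or.inl ENNReal.one_ne_top)))
  exact tendsto_nhds_unique hlaplace (hexponent.congr fun n => (hξ.laplace_simpleFunc _).symm)

end IsPoissonProcess

end Laplace

/-! ### Conditional independence -/

section CondUncorrelated

variable {Ω : Type*} {m mΩ : MeasurableSpace Ω} {μ : Measure Ω} {U V : Ω → ℝ≥0∞}

/-- The conditional expectation given `m` of the product of `U` and `V` is the product of their
conditional expectations. Conditional independence is stated through it for `[0, ∞]`-valued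
functions, whose conditional expectations need no integrability. -/
def CondUncorrelated (m : MeasurableSpace Ω) {_ : MeasurableSpace Ω} (μ : Measure Ω)
    (U V : Ω → ℝ≥0∞) : Prop :=
  μ⁻[fun ω => U ω * V ω|m] =ᵐ[μ] fun ω => μ⁻[U|m] ω * μ⁻[V|m] ω

lemma CondUncorrelated.symm (h : CondUncorrelated m μ U V) : CondUncorrelated m μ V U := by
  simpa only [CondUncorrelated, mul_comm] using h

lemma lintegral_mul_condLExp (hm : m ≤ mΩ) [SigmaFinite (μ.trim hm)] (hU : Measurable U)
    {W : Ω → ℝ≥0∞} (hW : Measurable[m] W) :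
    ∫⁻ ω, μ⁻[U|m] ω * W ω ∂μ = ∫⁻ ω, U ω * W ω ∂μ := by
  have hdensity : (μ.withDensity μ⁻[U|m]).trim hm = (μ.withDensity U).trim hm := by
    refine @Measure.ext _ m _ _ fun s hs => ?_
    rw [trim_measurableSet_eq hm hs, trim_measurableSet_eq hm hs, withDensity_apply _ (hm s hs),
      withDensity_apply _ (hm s hs), setLIntegral_condLExp hm μ U hs]
  have hW' : Measurable W := hW.mono hm le_rfl
  have hmul := lintegral_withDensity_eq_lintegral_mul μ hU hW'
  have hmul' := lintegral_withDensity_eq_lintegral_mul μ (measurable_condLExp' m μ U) hW'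
  simp only [Pi.mul_apply] at hmul hmul'
  rw [← hmul, ← hmul', ← lintegral_trim hm hW, ← lintegral_trim hm hW, hdensity]

lemma setLIntegral_condLExp_mul_condLExp (hm : m ≤ mΩ) [SigmaFinite (μ.trim hm)]
    (hU : Measurable U) (V : Ω → ℝ≥0∞) {s : Set Ω} (hs : MeasurableSet[m] s) :
    ∫⁻ ω in s, μ⁻[U|m] ω * μ⁻[V|m] ω ∂μ = ∫⁻ ω in s, U ω * μ⁻[V|m] ω ∂μ := by
  simpa only [← Set.indicator_mul_right, lintegral_indicator (hm s hs)] using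
    lintegral_mul_condLExp hm hU ((measurable_condLExp m μ V).indicator hs)

lemma condUncorrelated_iff (hm : m ≤ mΩ) [SigmaFinite (μ.trim hm)] (hU : Measurable U) :
    CondUncorrelated m μ U V ↔ ∀ s, MeasurableSet[m] s →
      ∫⁻ ω in s, U ω * V ω ∂μ = ∫⁻ ω in s, U ω * μ⁻[V|m] ω ∂μ := by
  constructor
  · intro h s hs
    rw [← setLIntegral_condLExp_mul_condLExp hm hU V hs, ← setLIntegral_condLExp hm μ _ hs]
    exact lintegral_congr_ae (ae_restrict_of_ae h)
  · intro h
    refine (ae_eq_condLExp hm μ _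
      ((measurable_condLExp m μ U).mul (measurable_condLExp m μ V)) fun s hs => ?_).symm
    simp only [Pi.mul_apply]
    rw [setLIntegral_condLExp_mul_condLExp hm hU V hs, h s hs]

theorem condUncorrelated_indicator_of_laplace {E : Type*} [MeasurableSpace E] (hm : m ≤ mΩ)
    [SigmaFinite (μ.trim hm)] {X : Ω → Measure E} (hX : Measurable X) (hV : Measurable V)
    (hV_fin : ∫⁻ ω, V ω ∂μ ≠ ∞)
    (h : ∀ f : E → ℝ≥0∞, Measurable f →
      CondUncorrelated m μ (fun ω => expNeg (∫⁻ y, f y ∂(X ω))) V)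
    {A : Set (Measure E)} (hA : MeasurableSet A) :
    CondUncorrelated m μ ((X ⁻¹' A).indicator 1) V := by
  have hA' : MeasurableSet (X ⁻¹' A) := hX hA
  have hV' := measurable_condLExp' m μ V
  refine (condUncorrelated_iff hm (measurable_one.indicator hA')).2 fun s hs => ?_
  have := isFiniteMeasure_withDensity (μ := μ.restrict s)
    (ne_top_of_le_ne_top hV_fin (setLIntegral_le_lintegral s V))
  have := isFiniteMeasure_withDensity (μ := μ.restrict s) (f := μ⁻[V|m]) <| by
    rw [setLIntegral_condLExp hm μ V hs]
    exact ne_top_of_le_ne_top hV_fin (setLIntegral_le_lintegral s V)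
  have hmap : ((μ.restrict s).withDensity V).map X =
      ((μ.restrict s).withDensity μ⁻[V|m]).map X := by
    refine ext_of_laplace fun f hf => ?_
    rw [lintegral_map (by fun_prop) hX, lintegral_map (by fun_prop) hX,
      lintegral_withDensity_eq_lintegral_mul _ hV (by fun_prop),
      lintegral_withDensity_eq_lintegral_mul _ hV' (by fun_prop)]
    simpa only [Pi.mul_apply, mul_comm] using
      (condUncorrelated_iff hm (by fun_prop)).1 (h f hf) s hs
  have happly := congrArg (· A) hmap
  simp only [Measure.map_apply hX hA, withDensity_apply _ hA', ← lintegral_indicator hA']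
    at happly
  simpa only [← Set.indicator_mul_left, Pi.one_apply, one_mul] using happly

end CondUncorrelated

section CondIndep

variable {Ω : Type*} [MeasurableSpace Ω] {μ : Measure Ω} [IsFiniteMeasure μ]

theorem condIndep_iff_condUncorrelated {S₁ S₂ S₃ : Type*} [MeasurableSpace S₁]
    [MeasurableSpace S₂] [MeasurableSpace S₃] {X : Ω → S₁} {Y : Ω → S₂} {Z : Ω → S₃}
    (hX : Measurable X) (hY : Measurable Y) :
    CondIndep X Y Z μ ↔ ∀ (A : Set S₁) (B : Set S₂), MeasurableSet A → MeasurableSet B →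
      CondUncorrelated (.comap Z inferInstance) μ ((X ⁻¹' A).indicator 1)
        ((Y ⁻¹' B).indicator 1) := by
  have hcondExp {A : Set Ω} (hA : MeasurableSet A) :
      (fun ω => (μ⁻[A.indicator 1|.comap Z inferInstance] ω).toReal) =ᵐ[μ]
        μ⟦A|.comap Z inferInstance⟧ := by
    convert toReal_condLExp (μ := μ) (.comap Z inferInstance)
      (measurable_one.indicator hA).aemeasurable
      (by simp [lintegral_indicator_one hA]) using 3 with ω
    by_cases hω : ω ∈ A <;> simp [hω]
  have hfin (A : Set Ω) : ∀ᵐ ω ∂μ, μ⁻[A.indicator 1|.comap Z inferInstance] ω ≠ ∞ := by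
    refine condLExp_ne_top (ne_top_of_le_ne_top (measure_ne_top μ Set.univ) ?_)
    simpa using lintegral_mono (μ := μ) (Set.indicator_le_self A 1)
  refine forall₄_congr fun A B hA hB => ?_
  have hprod : (fun ω => (X ⁻¹' A).indicator 1 ω * (Y ⁻¹' B).indicator 1 ω) =
      (X ⁻¹' A ∩ Y ⁻¹' B).indicator (1 : Ω → ℝ≥0∞) := by
    rw [Set.inter_indicator_one]
    rfl
  rw [CondUncorrelated, hprod]
  refine Filter.eventually_congr ?_
  filter_upwards [hcondExp (hX hA), hcondExp (hY hB), hcondExp ((hX hA).inter (hY hB)),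
    hfin (X ⁻¹' A), hfin (Y ⁻¹' B), hfin (X ⁻¹' A ∩ Y ⁻¹' B)] with ω hA hB hAB hA' hB' hAB'
  rw [Pi.mul_apply, ← hA, ← hB, ← hAB, ← ENNReal.toReal_mul,
    ENNReal.toReal_eq_toReal_iff' hAB' (ENNReal.mul_ne_top hA' hB')]

theorem condIndep_of_laplace {E₁ E₂ S : Type*} [MeasurableSpace E₁] [MeasurableSpace E₂]
    [MeasurableSpace S] {X : Ω → Measure E₁} {Y : Ω → Measure E₂} {Z : Ω → S}
    (hX : Measurable X) (hY : Measurable Y) (hZ : Measurable Z)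
    (h : ∀ (f₁ : E₁ → ℝ≥0∞) (f₂ : E₂ → ℝ≥0∞), Measurable f₁ → Measurable f₂ →
      CondUncorrelated (.comap Z inferInstance) μ (fun ω => expNeg (∫⁻ y, f₁ y ∂(X ω)))
        fun ω => expNeg (∫⁻ y, f₂ y ∂(Y ω))) :
    CondIndep X Y Z μ := by
  have hfin {U : Ω → ℝ≥0∞} (hU : ∀ ω, U ω ≤ 1) : ∫⁻ ω, U ω ∂μ ≠ ∞ :=
    ne_top_of_le_ne_top (measure_ne_top μ Set.univ) (by simpa using lintegral_mono (μ := μ) hU)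
  refine (condIndep_iff_condUncorrelated hX hY).2 fun A B hA hB => ?_
  refine condUncorrelated_indicator_of_laplace hZ.comap_le hX (measurable_one.indicator (hY hB))
    (hfin (Set.indicator_le_self _ _)) (fun f₁ hf₁ => .symm ?_) hA
  exact condUncorrelated_indicator_of_laplace hZ.comap_le hY (by fun_prop)
    (hfin fun ω => expNeg_le_one _) (fun f₂ hf₂ => (h f₁ f₂ hf₁ hf₂).symm) hB

end CondIndep

/-! ### Marked Poisson processes -/

section Marking

variable {Ω E S : Type*} [MeasurableSpace Ω] [MeasurableSpace E] [MeasurableSpace S]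
  {μ : Measure Ω}

lemma iIndepFun_prodMk {ι α β : Type*} [MeasurableSpace α] [MeasurableSpace β]
    {X : ι → Ω → α} {Y : ι → Ω → β} (hX : iIndepFun X μ) (hY : iIndepFun Y μ)
    (hXm : ∀ i, Measurable (X i)) (hYm : ∀ i, Measurable (Y i))
    (hXY : IndepFun (fun ω i => X i ω) (fun ω i => Y i ω) μ) :
    iIndepFun (fun i ω => (X i ω, Y i ω)) μ := by
  have hgen (i : ι) : (inferInstance : MeasurableSpace (α × β)).comap (fun ω => (X i ω, Y i ω)) =
      .generateFrom (Set.preimage (fun ω => (X i ω, Y i ω)) '' Set.image2 (· ×ˢ ·)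
        {A | MeasurableSet A} {B | MeasurableSet B}) := by
    rw [← MeasurableSpace.comap_generateFrom, generateFrom_prod]
  refine iIndepSets.iIndep (fun i => ((hXm i).prodMk (hYm i)).comap_le) _
    (fun i => isPiSystem_prod.comap _) hgen ?_
  refine iIndepSets_iff _ _ |>.2 fun s f hf => ?_
  choose! C hC hCf using hf
  choose! A hA B hB hAB using hC
  have hf (i : ι) (hi : i ∈ s) : f i = X i ⁻¹' A i ∩ Y i ⁻¹' B i := by
    rw [← hCf i hi, ← hAB i hi]
    rfl
  have hA' : MeasurableSet (⋂ i ∈ s, {x : ι → α | x i ∈ A i}) :=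
    s.measurableSet_biInter fun i hi => measurable_pi_apply i (hA i hi)
  have hB' : MeasurableSet (⋂ i ∈ s, {y : ι → β | y i ∈ B i}) :=
    s.measurableSet_biInter fun i hi => measurable_pi_apply i (hB i hi)
  have hsplit : ⋂ i ∈ s, X i ⁻¹' A i ∩ Y i ⁻¹' B i =
      (⋂ i ∈ s, X i ⁻¹' A i) ∩ ⋂ i ∈ s, Y i ⁻¹' B i := by
    simp only [Set.iInter_inter_distrib]
  have hpair : μ ((⋂ i ∈ s, X i ⁻¹' A i) ∩ ⋂ i ∈ s, Y i ⁻¹' B i) =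
      μ (⋂ i ∈ s, X i ⁻¹' A i) * μ (⋂ i ∈ s, Y i ⁻¹' B i) := by
    simpa only [Set.preimage_iInter] using! hXY.measure_inter_preimage_eq_mul _ _ hA' hB'
  have hpair_single (i : ι) (hi : i ∈ s) :
      μ (f i) = μ (X i ⁻¹' A i) * μ (Y i ⁻¹' B i) := by
    rw [hf i hi]
    exact (hXY.comp (measurable_pi_apply i) (measurable_pi_apply i)).measure_inter_preimage_eq_mul
      _ _ (hA i hi) (hB i hi)
  rw [Set.iInter₂_congr hf, hsplit, hpair, hX.measure_inter_preimage_eq_mul s hA,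
    hY.measure_inter_preimage_eq_mul s hB, Finset.prod_congr rfl hpair_single,
    Finset.prod_mul_distrib]

lemma lintegral_comp_prodMk_of_indepFun {α β : Type*} [MeasurableSpace α] [MeasurableSpace β]
    [IsFiniteMeasure μ] {X : Ω → α} {Y : Ω → β} (hX : Measurable X) (hY : Measurable Y)
    (hXY : IndepFun X Y μ) {F : α × β → ℝ≥0∞} (hF : Measurable F) :
    ∫⁻ ω, F (X ω, Y ω) ∂μ = ∫⁻ ω, ∫⁻ ω', F (X ω, Y ω') ∂μ ∂μ := by
  rw [← lintegral_map hF (hX.prodMk hY),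
    hXY.map_prod_eq_prod_map_map hX.aemeasurable hY.aemeasurable,
    lintegral_prod _ hF.aemeasurable, lintegral_map hF.lintegral_prod_right' hX]
  exact lintegral_congr fun ω => lintegral_map (hF.comp measurable_prodMk_left) hY

lemma lintegral_expNeg_le_one [IsProbabilityMeasure μ] (U : Ω → ℝ≥0∞) :
    ∫⁻ ω, expNeg (U ω) ∂μ ≤ 1 :=
  (lintegral_mono fun _ => expNeg_le_one _).trans (by simp)

lemma lintegral_expNeg_tsum_of_iIndepFun [IsProbabilityMeasure μ] {U : ℕ → Ω → ℝ≥0∞}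
    (hU : ∀ i, Measurable (U i)) (hindep : iIndepFun U μ) :
    ∫⁻ ω, expNeg (∑' i, U i ω) ∂μ = expNeg (∑' i, negLog (∫⁻ ω, expNeg (U i ω) ∂μ)) := by
  have hpartial : Filter.Tendsto (fun n => ∫⁻ ω, expNeg (∑ i ∈ Finset.range n, U i ω) ∂μ)
      Filter.atTop (nhds (∫⁻ ω, expNeg (∑' i, U i ω) ∂μ)) :=
    tendsto_lintegral_of_dominated_convergence (fun _ => 1)
      (fun n => measurable_expNeg.comp (Finset.measurable_sum _ fun i _ => hU i))
      (fun n => ae_of_all _ fun ω => expNeg_le_one _) (by simp)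
      (ae_of_all _ fun ω => (continuous_expNeg.tendsto _).comp (ENNReal.tendsto_nat_tsum _))
  refine tendsto_nhds_unique hpartial (((continuous_expNeg.tendsto _).comp
    (ENNReal.tendsto_nat_tsum fun i => negLog (∫⁻ ω, expNeg (U i ω) ∂μ))).congr fun n => ?_)
  simp only [Function.comp_apply, expNeg_sum]
  have hindep' : iIndepFun (fun i ω => expNeg (U i ω)) μ :=
    hindep.comp (fun _ => expNeg) fun _ => measurable_expNeg
  rw [lintegral_prod_eq_prod_lintegral_of_indepFun _ _ hindep' fun i => by fun_prop]
  exact Finset.prod_congr rfl fun i _ => expNeg_negLog (lintegral_expNeg_le_one _)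

lemma lintegral_pointSum (κ : ℕ∞) (y : ℕ → E) {f : E → ℝ≥0∞} (hf : Measurable f) :
    ∫⁻ x, f x ∂(pointSum κ y) = ∑' i : ℕ, if (i : ℕ∞) < κ then f (y i) else 0 := by
  rw [pointSum, lintegral_sum_measure]
  refine tsum_congr fun i => ?_
  split_ifs
  · exact lintegral_dirac' _ hf
  · simp

lemma map_pointSum {F : Type*} [MeasurableSpace F] (κ : ℕ∞) (y : ℕ → E) {g : E → F}
    (hg : Measurable g) : (pointSum κ y).map g = pointSum κ fun i => g (y i) := by
  refine Measure.ext_of_lintegral _ fun f hf => ?_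
  rw [lintegral_map hf hg, lintegral_pointSum κ y (f := fun x => f (g x)) (by fun_prop),
    lintegral_pointSum κ _ hf]

lemma measurableSet_natCast_lt (i : ℕ) : MeasurableSet {k : ℕ∞ | (i : ℕ∞) < k} := .of_discrete

lemma measurable_pointSum {κ : Ω → ℕ∞} {η : ℕ → Ω → E} (hκ : Measurable κ)
    (hη : ∀ i, Measurable (η i)) : Measurable fun ω => pointSum (κ ω) fun i => η i ω := by
  refine Measure.measurable_of_measurable_coe _ fun A hA => ?_
  simp_rw [← lintegral_indicator_one hA, lintegral_pointSum _ _ (measurable_one.indicator hA)]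
  exact Measurable.tsum fun i => Measurable.ite (hκ (measurableSet_natCast_lt i))
    ((measurable_one.indicator hA).comp (hη i)) measurable_const

lemma lintegral_expNeg_tsum_marked [IsProbabilityMeasure μ] {ζ : ℕ → Ω → S} {ν : Measure S}
    [SFinite ν] (hζ : ∀ i, Measurable (ζ i)) (hζ_law : ∀ i, μ.map (ζ i) = ν)
    (hζ_indep : iIndepFun ζ μ) (κ : ℕ∞) (y : ℕ → E) {F : E × S → ℝ≥0∞} (hF : Measurable F) :
    ∫⁻ ω, expNeg (∑' i : ℕ, if (i : ℕ∞) < κ then F (y i, ζ i ω) else 0) ∂μ =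
      expNeg (∫⁻ x, negLog (∫⁻ s, expNeg (F (x, s)) ∂ν) ∂(pointSum κ y)) := by
  have hG : Measurable fun x => negLog (∫⁻ s, expNeg (F (x, s)) ∂ν) :=
    measurable_negLog.comp (measurable_expNeg.comp hF).lintegral_prod_right'
  have hterm (i : ℕ) : Measurable fun s => if (i : ℕ∞) < κ then F (y i, s) else 0 := by
    split_ifs <;> fun_prop
  have hterm_indep :
      iIndepFun (fun (i : ℕ) ω => if (i : ℕ∞) < κ then F (y i, ζ i ω) else 0) μ :=
    hζ_indep.comp _ hterm
  refine (lintegral_expNeg_tsum_of_iIndepFun (fun i => (hterm i).comp (hζ i))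
    hterm_indep).trans ?_
  rw [lintegral_pointSum _ _ hG]
  congr 2 with i
  simp only [Function.comp_apply]
  split_ifs
  · rw [← hζ_law i, lintegral_map (by fun_prop) (hζ i)]
  · simpa using negLog_expNeg 0

theorem IsPoissonEnumeration.hasPoissonLaplace_marked [IsProbabilityMeasure μ] {κ : Ω → ℕ∞}
    {η : ℕ → Ω → E} {Λ : Measure E} {ζ : ℕ → Ω → S} {ν : Measure S}
    [IsProbabilityMeasure ν] (h : IsPoissonEnumeration κ η Λ μ) (hζ : ∀ i, Measurable (ζ i))
    (hζ_law : ∀ i, μ.map (ζ i) = ν) (hζ_indep : iIndepFun ζ μ)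
    (hindep : IndepFun (fun ω => (κ ω, fun i => η i ω)) (fun ω i => ζ i ω) μ) :
    HasPoissonLaplace (fun ω => pointSum (κ ω) fun i => (η i ω, ζ i ω)) (Λ.prod ν) μ := by
  have hκ := h.measurable_count
  have hη := h.measurable_point
  refine ⟨measurable_pointSum hκ fun i => (hη i).prodMk (hζ i), fun {F} hF => ?_⟩
  let G (y : E) : ℝ≥0∞ := negLog (∫⁻ s, expNeg (F (y, s)) ∂ν)
  have hG : Measurable G :=
    measurable_negLog.comp (measurable_expNeg.comp hF).lintegral_prod_right'
  calc ∫⁻ ω, expNeg (∫⁻ q, F q ∂(pointSum (κ ω) fun i => (η i ω, ζ i ω))) ∂μ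
      = ∫⁻ ω, expNeg (∑' i : ℕ, if (i : ℕ∞) < κ ω then F (η i ω, ζ i ω) else 0) ∂μ := by
        simp_rw [lintegral_pointSum _ _ hF]
    _ = ∫⁻ ω, ∫⁻ ω', expNeg (∑' i : ℕ, if (i : ℕ∞) < κ ω then F (η i ω, ζ i ω') else 0) ∂μ ∂μ := by
        refine lintegral_comp_prodMk_of_indepFun (hκ.prodMk (measurable_pi_lambda _ hη))
          (measurable_pi_lambda _ hζ) hindep (F := fun p => expNeg (∑' i : ℕ,
            if (i : ℕ∞) < p.1.1 then F (p.1.2 i, p.2 i) else 0)) ?_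
        exact measurable_expNeg.comp (Measurable.tsum fun i =>
          Measurable.ite (measurable_fst.fst (measurableSet_natCast_lt i)) (by fun_prop)
            measurable_const)
    _ = ∫⁻ ω, expNeg (∫⁻ y, G y ∂(pointSum (κ ω) fun i => η i ω)) ∂μ :=
        lintegral_congr fun ω =>
          lintegral_expNeg_tsum_marked hζ hζ_law hζ_indep (κ ω) (fun i => η i ω) hF
    _ = expNeg (∫⁻ y, (1 - ∫⁻ s, expNeg (F (y, s)) ∂ν) ∂Λ) := by
        rw [h.isPoisson.hasPoissonLaplace.laplace hG]
        simp only [G, expNeg_negLog (lintegral_expNeg_le_one _)]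
    _ = expNeg (∫⁻ q, (1 - expNeg (F q)) ∂(Λ.prod ν)) := by
        rw [lintegral_prod _ (Measurable.aemeasurable (by fun_prop))]
        congr 2 with y
        rw [lintegral_sub (by fun_prop)
          (ne_top_of_le_ne_top ENNReal.one_ne_top (lintegral_expNeg_le_one _))
          (ae_of_all _ fun s => expNeg_le_one _)]
        simp

end Marking

/-! ### Disintegration -/

section Disintegration

variable {α β : Type*} [MeasurableSpace α] [MeasurableSpace β]

lemma fst_withDensity_comp_fst (ρ : Measure (α × β)) {v : α → ℝ≥0∞} (hv : Measurable v) :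
    (ρ.withDensity fun p => v p.1).fst = ρ.fst.withDensity v := by
  ext s hs
  rw [Measure.fst_apply hs, withDensity_apply _ (measurable_fst hs), withDensity_apply _ hs,
    Measure.fst, setLIntegral_map hs hv measurable_fst]

lemma compProd_withDensity_comp_fst (M : Measure α) [SFinite M] (K : Kernel α β)
    [IsSFiniteKernel K] {v : α → ℝ≥0∞} (hv : Measurable v) :
    (M ⊗ₘ K).withDensity (fun p => v p.1) = M.withDensity v ⊗ₘ K := by
  refine Measure.ext_of_lintegral _ fun f hf => ?_
  have hsection (a : α) : Measurable fun b => f (a, b) := by fun_prop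
  rw [lintegral_withDensity_eq_lintegral_mul _ (by fun_prop) hf,
    Measure.lintegral_compProd (by fun_prop), Measure.lintegral_compProd hf,
    lintegral_withDensity_eq_lintegral_mul _ hv (by fun_prop)]
  simp only [Pi.mul_apply, lintegral_const_mul _ (hsection _)]

/-- Multiplying `ρ` by a positive function of the first coordinate makes it finite and does not
change its conditional kernel. -/
theorem exists_isMarkovKernel_compProd_eq [StandardBorelSpace β] [Nonempty β]
    (ρ : Measure (α × β)) [SigmaFinite ρ.fst] :
    ∃ K : Kernel α β, IsMarkovKernel K ∧ ρ = ρ.fst ⊗ₘ K := by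
  obtain ⟨u, hu_pos, hu, hu_lt⟩ := exists_pos_lintegral_lt_of_sigmaFinite ρ.fst one_ne_zero
  have hv : Measurable fun a => (u a : ℝ≥0∞)⁻¹ := by fun_prop
  have hfin : ∫⁻ p, u p.1 ∂ρ ≠ ∞ := by
    rw [Measure.fst, lintegral_map (by fun_prop) measurable_fst] at hu_lt
    exact (hu_lt.trans ENNReal.one_lt_top).ne
  obtain ⟨ρ', hρ'⟩ : ∃ ρ', ρ' = ρ.withDensity fun p => (u p.1 : ℝ≥0∞) := ⟨_, rfl⟩
  have : IsFiniteMeasure ρ' := hρ' ▸ isFiniteMeasure_withDensity hfin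
  have hρ : ρ'.withDensity (fun p => (u p.1 : ℝ≥0∞)⁻¹) = ρ :=
    hρ' ▸ withDensity_inv_same (by fun_prop)
      (ae_of_all _ fun p => ENNReal.coe_ne_zero.2 (hu_pos p.1).ne')
      (ae_of_all _ fun _ => ENNReal.coe_ne_top)
  refine ⟨ρ'.condKernel, inferInstance, ?_⟩
  calc ρ = (ρ'.fst ⊗ₘ ρ'.condKernel).withDensity fun p => (u p.1 : ℝ≥0∞)⁻¹ := by
        rw [ρ'.disintegrate ρ'.condKernel, hρ]
    _ = ρ'.fst.withDensity (fun a => (u a : ℝ≥0∞)⁻¹) ⊗ₘ ρ'.condKernel :=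
        compProd_withDensity_comp_fst (v := fun a => (u a : ℝ≥0∞)⁻¹) _ _ hv
    _ = ρ.fst ⊗ₘ ρ'.condKernel := by
        rw [← fst_withDensity_comp_fst (v := fun a => (u a : ℝ≥0∞)⁻¹) _ hv, hρ]

lemma comap_eq_iff_restrict_range_eq_map {f : α → β} (hf : MeasurableEmbedding f)
    (ρ : Measure β) (ν : Measure α) :
    ρ.comap f = ν ↔ ρ.restrict (Set.range f) = ν.map f := by
  rw [← hf.map_comap]
  exact ⟨congrArg _, fun h => by rw [← hf.comap_map (ρ.comap f), h, hf.comap_map]⟩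

end Disintegration

/-! ### The punctured product space -/

section PuncturedProduct

variable {E₁ E₂ E₃ : Type*} {o₁ : E₁} {o₂ : E₂} {o₃ : E₃}

lemma range_inclThird :
    Set.range (inclThird : E₁ × E₂ × Punctured o₃ → Punctured (o₁, o₂, o₃)) =
      {y | y.1.2.2 = o₃}ᶜ := by
  ext y
  constructor
  · rintro ⟨p, rfl⟩
    exact p.2.2.2
  · intro hy
    exact ⟨(y.1.1, y.1.2.1, ⟨y.1.2.2, hy⟩), rfl⟩

variable [MeasurableSpace E₁] [MeasurableSpace E₂] [MeasurableSpace E₃]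

@[fun_prop]
lemma measurable_coord₁ : Measurable fun y : Punctured (o₁, o₂, o₃) => y.1.1 :=
  measurable_subtype_coe.fst

@[fun_prop]
lemma measurable_coord₂ : Measurable fun y : Punctured (o₁, o₂, o₃) => y.1.2.1 :=
  measurable_subtype_coe.snd.fst

@[fun_prop]
lemma measurable_coord₃ : Measurable fun y : Punctured (o₁, o₂, o₃) => y.1.2.2 :=
  measurable_subtype_coe.snd.snd

lemma measurable_coord₁₂ :
    Measurable fun y : Punctured (o₁, o₂, o₃) => (y.1.1, y.1.2.1) := by
  fun_prop

@[fun_prop]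
lemma measurable_inclThird :
    Measurable (inclThird : E₁ × E₂ × Punctured o₃ → Punctured (o₁, o₂, o₃)) :=
  Measurable.subtype_mk (by fun_prop)

/-- The rearrangement of coordinates that moves the conditioning coordinate, which comes first in
a composition-product `M ⊗ₘ K`, to the last place. -/
def thirdLast : Punctured o₃ × (E₁ × E₂) ≃ᵐ E₁ × E₂ × Punctured o₃ :=
  MeasurableEquiv.prodComm.trans MeasurableEquiv.prodAssoc

/-- The inclusion of `(E₃ \ {o₃}) × (E₁ × E₂)` into the punctured product space. -/
def insertThird (q : Punctured o₃ × (E₁ × E₂)) : Punctured (o₁, o₂, o₃) :=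
  inclThird (thirdLast q)

@[fun_prop]
lemma measurable_insertThird :
    Measurable (insertThird : Punctured o₃ × (E₁ × E₂) → Punctured (o₁, o₂, o₃)) :=
  measurable_inclThird.comp thirdLast.measurable

@[fun_prop]
lemma measurable_axis₃ : Measurable (axis₃ : Punctured o₃ → Punctured (o₁, o₂, o₃)) :=
  measurable_inclThird.comp (by fun_prop)

section Singleton

variable [MeasurableSingletonClass E₃]

lemma measurableSet_third : MeasurableSet {y : Punctured (o₁, o₂, o₃) | y.1.2.2 = o₃} :=
  measurable_coord₃ (measurableSet_singleton o₃)

lemma measurableSet_first_third [MeasurableSingletonClass E₁] :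
    MeasurableSet {y : Punctured (o₁, o₂, o₃) | y.1.1 = o₁ ∧ y.1.2.2 = o₃} :=
  (measurable_coord₁ (measurableSet_singleton o₁)).inter measurableSet_third

lemma measurableSet_second_third [MeasurableSingletonClass E₂] :
    MeasurableSet {y : Punctured (o₁, o₂, o₃) | y.1.2.1 = o₂ ∧ y.1.2.2 = o₃} :=
  (measurable_coord₂ (measurableSet_singleton o₂)).inter measurableSet_third

lemma measurableSet_off_axes [MeasurableSingletonClass E₁] [MeasurableSingletonClass E₂] :
    MeasurableSet {y : Punctured (o₁, o₂, o₃) | y.1.1 ≠ o₁ ∧ y.1.2.1 ≠ o₂ ∧ y.1.2.2 = o₃} :=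
  (measurable_coord₁ (measurableSet_singleton o₁).compl).inter
    ((measurable_coord₂ (measurableSet_singleton o₂).compl).inter measurableSet_third)

lemma measurableEmbedding_puncturedVal :
    MeasurableEmbedding (Subtype.val : Punctured o₃ → E₃) :=
  MeasurableEmbedding.subtype_coe (measurableSet_singleton o₃).compl

lemma measurableEmbedding_inclThird :
    MeasurableEmbedding (inclThird : E₁ × E₂ × Punctured o₃ → Punctured (o₁, o₂, o₃)) := by
  refine MeasurableEmbedding.of_measurable_inverse_on_range measurable_inclThird
    (range_inclThird ▸ measurableSet_third.compl)
    (g := fun z => (z.1.1.1, z.1.1.2.1, ⟨z.1.1.2.2, range_inclThird.subset z.2⟩)) ?_ fun _ => rfl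
  exact Measurable.prodMk (by fun_prop)
    (Measurable.prodMk (by fun_prop) (Measurable.subtype_mk (by fun_prop)))

lemma marginal₃_eq_map_restrictThird (Λ : Measure (Punctured (o₁, o₂, o₃))) :
    marginal₃ Λ = (restrictThird Λ).map fun p => p.2.2 := by
  have hrange : (fun y : Punctured (o₁, o₂, o₃) => y.1.2.2) ⁻¹'
      Set.range (Subtype.val : Punctured o₃ → E₃) =
      Set.range (inclThird : E₁ × E₂ × Punctured o₃ → Punctured (o₁, o₂, o₃)) := by
    rw [Subtype.range_coe_subtype, range_inclThird]
    rfl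
  rw [marginal₃, comap_eq_iff_restrict_range_eq_map measurableEmbedding_puncturedVal]
  calc (proj₃ Λ).restrict (Set.range (Subtype.val : Punctured o₃ → E₃))
      = (Λ.restrict (Set.range inclThird)).map fun y => y.1.2.2 := by
        rw [proj₃, Measure.restrict_map measurable_coord₃
          measurableEmbedding_puncturedVal.measurableSet_range, hrange]
    _ = ((restrictThird Λ).map inclThird).map fun y => y.1.2.2 := by
        rw [restrictThird, measurableEmbedding_inclThird.map_comap]
    _ = ((restrictThird Λ).map fun p => p.2.2).map Subtype.val := by
        rw [Measure.map_map measurable_coord₃ measurable_inclThird,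
          Measure.map_map measurable_subtype_coe (by fun_prop)]
        rfl

section Measure

variable {Λ : Measure (Punctured (o₁, o₂, o₃))}

lemma sigmaFinite_marginal₃ {L₁ : ℕ → Set E₁} {L₂ : ℕ → Set E₂} {L₃ : ℕ → Set E₃}
    (hL₃ : IsLocalizing o₃ L₃) (hΛ : ∀ h, Λ (localizingProd L₁ L₂ L₃ h) < ∞) :
    SigmaFinite (marginal₃ Λ) := by
  refine ⟨⟨⟨fun h => Subtype.val ⁻¹' L₃ h, fun _ => trivial, fun h => ?_, ?_⟩⟩⟩
  · calc marginal₃ Λ (Subtype.val ⁻¹' L₃ h)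
        = proj₃ Λ (Subtype.val '' (Subtype.val ⁻¹' L₃ h)) :=
          measurableEmbedding_puncturedVal.comap_apply _ _
      _ ≤ proj₃ Λ (L₃ h) := measure_mono (Set.image_preimage_subset _ _)
      _ = Λ {y | y.1.2.2 ∈ L₃ h} := Measure.map_apply measurable_coord₃ (hL₃.measurableSet h)
      _ ≤ Λ (localizingProd L₁ L₂ L₃ h) := measure_mono fun y hy => Or.inr (Or.inr hy)
      _ < ∞ := hΛ h
  · rw [← Set.preimage_iUnion, hL₃.iUnion_eq]
    exact Set.eq_univ_of_forall fun y => y.2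

lemma isDisintegration_iff [SFinite (marginal₃ Λ)] {K : Kernel (Punctured o₃) (E₁ × E₂)} :
    IsDisintegration Λ K ↔ IsMarkovKernel K ∧
      Λ.restrict {y | y.1.2.2 = o₃}ᶜ = (marginal₃ Λ ⊗ₘ K).map insertThird := by
  refine and_congr_right fun _ => ?_
  have hsection {A : Set (E₁ × E₂ × Punctured o₃)} (hA : MeasurableSet A) :
      ((marginal₃ Λ ⊗ₘ K).map thirdLast) A =
        ∫⁻ y₃, K y₃ {p | (p.1, p.2, y₃) ∈ A} ∂(marginal₃ Λ) := by
    rw [thirdLast.map_apply, Measure.compProd_apply (thirdLast.measurable hA)]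
    rfl
  have hmap : (marginal₃ Λ ⊗ₘ K).map insertThird =
      (((marginal₃ Λ ⊗ₘ K).map thirdLast).map inclThird : Measure (Punctured (o₁, o₂, o₃))) :=
    (Measure.map_map measurable_inclThird thirdLast.measurable).symm
  rw [hmap, ← range_inclThird,
    ← comap_eq_iff_restrict_range_eq_map measurableEmbedding_inclThird, Measure.ext_iff]
  exact forall₂_congr fun A hA => by rw [hsection hA, restrictThird]

lemma exists_isDisintegration [StandardBorelSpace E₁] [StandardBorelSpace E₂]
    [SigmaFinite (marginal₃ Λ)] : ∃ K, IsDisintegration Λ K := by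
  have hfst : ((restrictThird Λ).map thirdLast.symm).fst = marginal₃ Λ := by
    rw [Measure.fst, Measure.map_map measurable_fst thirdLast.symm.measurable,
      marginal₃_eq_map_restrictThird]
    rfl
  have : SigmaFinite ((restrictThird Λ).map thirdLast.symm).fst := hfst ▸ inferInstance
  have : Nonempty (E₁ × E₂) := ⟨(o₁, o₂)⟩
  obtain ⟨K, hK, h⟩ := exists_isMarkovKernel_compProd_eq ((restrictThird Λ).map thirdLast.symm)
  refine ⟨K, isDisintegration_iff.2 ⟨hK, ?_⟩⟩
  rw [hfst] at h
  change _ = (marginal₃ Λ ⊗ₘ K).map (inclThird ∘ thirdLast)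
  rw [← Measure.map_map measurable_inclThird thirdLast.measurable, ← h,
    MeasurableEquiv.map_map_symm, ← range_inclThird, restrictThird,
    measurableEmbedding_inclThird.map_comap]

lemma restrict_third_eq_add [MeasurableSingletonClass E₁]
    (h : Λ {y | y.1.1 ≠ o₁ ∧ y.1.2.1 ≠ o₂ ∧ y.1.2.2 = o₃} = 0) :
    Λ.restrict {y | y.1.2.2 = o₃} = Λ.restrict {y | y.1.2.1 = o₂ ∧ y.1.2.2 = o₃} +
      Λ.restrict {y | y.1.1 = o₁ ∧ y.1.2.2 = o₃} := by
  have hdisj : Disjoint {y : Punctured (o₁, o₂, o₃) | y.1.2.1 = o₂ ∧ y.1.2.2 = o₃}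
      {y | y.1.1 = o₁ ∧ y.1.2.2 = o₃} := Set.disjoint_left.2 fun y h₂ h₁ =>
    y.2 (Prod.ext h₁.1 (Prod.ext h₂.1 h₁.2))
  rw [← Measure.restrict_union hdisj measurableSet_first_third]
  refine Measure.restrict_congr_set ?_
  filter_upwards [measure_eq_zero_iff_ae_notMem.1 h] with y hy
  change ¬(y.1.1 ≠ o₁ ∧ y.1.2.1 ≠ o₂ ∧ y.1.2.2 = o₃) at hy
  apply propext
  change y.1.2.2 = o₃ ↔ (y.1.2.1 = o₂ ∧ y.1.2.2 = o₃) ∨ (y.1.1 = o₁ ∧ y.1.2.2 = o₃)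
  tauto

end Measure

/-- The measure that agrees with `Λ` on the first two axes and has conditional kernel `K` where the
third coordinate is not `o₃`, with no mass elsewhere. -/
noncomputable def axialMean (Λ : Measure (Punctured (o₁, o₂, o₃)))
    (K : Kernel (Punctured o₃) (E₁ × E₂)) : Measure (Punctured (o₁, o₂, o₃)) :=
  Λ.restrict {y | y.1.2.1 = o₂ ∧ y.1.2.2 = o₃} + Λ.restrict {y | y.1.1 = o₁ ∧ y.1.2.2 = o₃} +
    (marginal₃ Λ ⊗ₘ K).map insertThird

theorem eq_axialMean_iff [MeasurableSingletonClass E₁] [MeasurableSingletonClass E₂]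
    {Λ : Measure (Punctured (o₁, o₂, o₃))} [SFinite (marginal₃ Λ)]
    {K : Kernel (Punctured o₃) (E₁ × E₂)} [IsMarkovKernel K] :
    Λ = axialMean Λ K ↔
      IsDisintegration Λ K ∧ Λ {y | y.1.1 ≠ o₁ ∧ y.1.2.1 ≠ o₂ ∧ y.1.2.2 = o₃} = 0 := by
  rw [isDisintegration_iff, and_iff_right ‹IsMarkovKernel K›]
  constructor
  · intro h
    have happly {A : Set (Punctured (o₁, o₂, o₃))} (hA : MeasurableSet A)
        (hA_axes : ∀ y ∈ A, y.1.2.2 = o₃ → y.1.1 ≠ o₁ ∧ y.1.2.1 ≠ o₂) :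
        Λ A = (marginal₃ Λ ⊗ₘ K) (insertThird ⁻¹' A) := by
      have hA₂ : A ∩ {y | y.1.2.1 = o₂ ∧ y.1.2.2 = o₃} = ∅ :=
        Set.eq_empty_of_forall_notMem fun y hy => (hA_axes y hy.1 hy.2.2).2 hy.2.1
      have hA₁ : A ∩ {y | y.1.1 = o₁ ∧ y.1.2.2 = o₃} = ∅ :=
        Set.eq_empty_of_forall_notMem fun y hy => (hA_axes y hy.1 hy.2.2).1 hy.2.1
      conv_lhs => rw [h, axialMean]
      rw [Measure.add_apply, Measure.add_apply, Measure.restrict_apply hA,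
        Measure.restrict_apply hA, Measure.map_apply measurable_insertThird hA, hA₁, hA₂,
        measure_empty, zero_add, zero_add]
    constructor
    · ext A hA
      have hinsert : insertThird ⁻¹' (A ∩ {y : Punctured (o₁, o₂, o₃) | y.1.2.2 = o₃}ᶜ) =
          insertThird ⁻¹' A := Set.inter_eq_left.2 fun q _ => q.1.2
      rw [Measure.restrict_apply hA, Measure.map_apply measurable_insertThird hA, ← hinsert]
      exact happly (hA.inter measurableSet_third.compl) fun y hy h₃ => absurd h₃ hy.2
    · rw [happly measurableSet_off_axes fun y hy _ => ⟨hy.1, hy.2.1⟩,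
        Set.eq_empty_of_forall_notMem (s := insertThird ⁻¹' _) fun q hq => q.1.2 hq.2.2,
        measure_empty]
  · rintro ⟨hK, hnull⟩
    rw [axialMean, ← hK, ← restrict_third_eq_add hnull,
      Measure.restrict_add_restrict_compl measurableSet_third]

end Singleton

end PuncturedProduct

/-! ### The conditional Laplace functional given the third projection -/

section CondLaplace

variable {E S Ω : Type*} [MeasurableSpace E] [MeasurableSpace S] [MeasurableSpace Ω]
  {M : Measure E} {μ : Measure Ω} {ξ : Ω → Measure E}

theorem condLExp_ae_eq_of_laplace [IsFiniteMeasure μ] {ζ : Ω → Measure S} (hζ : Measurable ζ)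
    {U : Ω → ℝ≥0∞} (hU : Measurable U) (hU_fin : ∫⁻ ω, U ω ∂μ ≠ ∞) {V : Measure S → ℝ≥0∞}
    (hV : Measurable V) (h : ∀ f : S → ℝ≥0∞, Measurable f →
      ∫⁻ ω, U ω * expNeg (∫⁻ z, f z ∂(ζ ω)) ∂μ = ∫⁻ ω, V (ζ ω) * expNeg (∫⁻ z, f z ∂(ζ ω)) ∂μ) :
    μ⁻[U|.comap ζ inferInstance] =ᵐ[μ] fun ω => V (ζ ω) := by
  have hVζ : Measurable fun ω => V (ζ ω) := hV.comp hζ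
  have htotal : ∫⁻ ω, U ω ∂μ = ∫⁻ ω, V (ζ ω) ∂μ := by simpa using h 0 measurable_zero
  have := isFiniteMeasure_withDensity (μ := μ) hU_fin
  have := isFiniteMeasure_withDensity (μ := μ) (htotal ▸ hU_fin)
  have hmap : (μ.withDensity fun ω => V (ζ ω)).map ζ = (μ.withDensity U).map ζ := by
    refine ext_of_laplace fun f hf => ?_
    rw [lintegral_map (by fun_prop) hζ, lintegral_map (by fun_prop) hζ,
      lintegral_withDensity_eq_lintegral_mul _ hVζ (by fun_prop),
      lintegral_withDensity_eq_lintegral_mul _ hU (by fun_prop)]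
    exact (h f hf).symm
  refine (ae_eq_condLExp hζ.comap_le μ _ (hV.comp (comap_measurable _)) ?_).symm
  rintro _ ⟨A, hA, rfl⟩
  simp only [Function.comp_apply]
  rw [← withDensity_apply _ (hζ hA), ← withDensity_apply _ (hζ hA), ← Measure.map_apply hζ hA,
    ← Measure.map_apply hζ hA, hmap]

theorem HasPoissonLaplace.condLExp_expNeg_lintegral (hξ : HasPoissonLaplace ξ M μ) {g : E → S}
    (hg : Measurable g) {F : E → ℝ≥0∞} (hF : Measurable F) {k : S → ℝ≥0∞} (hk : Measurable k)
    {a : ℝ≥0∞} (h : ∀ f : S → ℝ≥0∞, Measurable f →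
      ∫⁻ y, (1 - expNeg (F y + f (g y))) ∂M = a + ∫⁻ z, (1 - expNeg (k z + f z)) ∂(M.map g)) :
    μ⁻[fun ω => expNeg (∫⁻ y, F y ∂(ξ ω))|.comap (fun ω => (ξ ω).map g) inferInstance] =ᵐ[μ]
      fun ω => expNeg (a + ∫⁻ z, k z ∂((ξ ω).map g)) := by
  have := hξ.isProbabilityMeasure
  have hξm := hξ.measurable
  have hζ := hξ.map hg
  have hζm := hζ.measurable
  refine condLExp_ae_eq_of_laplace (V := fun ν => expNeg (a + ∫⁻ z, k z ∂ν)) hζm (by fun_prop)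
    (ne_top_of_le_ne_top ENNReal.one_ne_top (lintegral_expNeg_le_one _)) (by fun_prop)
    fun f hf => ?_
  have hleft (ω : Ω) : expNeg (∫⁻ y, F y ∂(ξ ω)) * expNeg (∫⁻ z, f z ∂((ξ ω).map g)) =
      expNeg (∫⁻ y, (F y + f (g y)) ∂(ξ ω)) := by
    rw [lintegral_map hf hg, lintegral_add_left hF, expNeg_add]
  have hright (ω : Ω) : expNeg (a + ∫⁻ z, k z ∂((ξ ω).map g)) *
      expNeg (∫⁻ z, f z ∂((ξ ω).map g)) =
      expNeg a * expNeg (∫⁻ z, (k z + f z) ∂((ξ ω).map g)) := by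
    rw [lintegral_add_left hk, expNeg_add, expNeg_add, mul_assoc]
  simp only [hleft, hright]
  rw [lintegral_const_mul _ (by fun_prop), hζ.laplace (by fun_prop), hξ.laplace (by fun_prop),
    h f hf, expNeg_add]

end CondLaplace

lemma setLIntegral_one_sub_expNeg_add {α : Type*} [MeasurableSpace α] {M : Measure α} {s : Set α}
    (hs : MeasurableSet s) (hM : M s = 0 ∨ M s = ∞) (F : α → ℝ≥0∞) {G : α → ℝ≥0∞} {c : ℝ≥0∞}
    (hG : ∀ y ∈ s, G y = c) :
    ∫⁻ y in s, (1 - expNeg (F y + G y)) ∂M =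
      ∫⁻ y in s, (1 - expNeg (F y)) ∂M + ∫⁻ y in s, (1 - expNeg (G y)) ∂M := by
  rw [setLIntegral_congr_fun (g := fun y => 1 - expNeg (F y + c)) hs
      fun y hy => by simp only [hG y hy],
    setLIntegral_congr_fun (f := fun y => 1 - expNeg (G y)) (g := fun _ => 1 - expNeg c) hs
      fun y hy => by simp only [hG y hy]]
  rcases hM with hM | hM
  · simp [Measure.restrict_eq_zero.2 hM]
  rcases eq_or_ne c 0 with rfl | hc
  · simp
  have hconst : ∫⁻ _ in s, (1 - expNeg c) ∂M = ∞ := by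
    rw [setLIntegral_const, hM, ENNReal.mul_top (mt one_sub_expNeg_eq_zero_iff.1 hc)]
  have hadd : ∫⁻ y in s, (1 - expNeg (F y + c)) ∂M = ∞ :=
    top_le_iff.1 <| hconst ▸ lintegral_mono fun y =>
      tsub_le_tsub_left (expNeg_strictAnti.antitone le_add_self) 1
  rw [hconst, hadd, add_top]

lemma lintegral_one_sub_expNeg_add_of_isProbabilityMeasure {α : Type*} [MeasurableSpace α]
    {P : Measure α} [IsProbabilityMeasure P] {F : α → ℝ≥0∞} (hF : Measurable F) (c : ℝ≥0∞) :
    ∫⁻ y, (1 - expNeg (F y + c)) ∂P = 1 - (∫⁻ y, expNeg (F y) ∂P) * expNeg c := by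
  rw [lintegral_sub (by fun_prop)
    (ne_top_of_le_ne_top ENNReal.one_ne_top (lintegral_expNeg_le_one _))
    (ae_of_all _ fun y => expNeg_le_one _)]
  simp only [expNeg_add]
  rw [lintegral_mul_const _ (by fun_prop), lintegral_one, measure_univ]

section Exponents

variable {E₁ E₂ E₃ : Type*} [MeasurableSpace E₁] [MeasurableSpace E₂] [MeasurableSpace E₃]
  {o₁ : E₁} {o₂ : E₂} {o₃ : E₃} {Λ : Measure (Punctured (o₁, o₂, o₃))}
  {K : Kernel (Punctured o₃) (E₁ × E₂)} {F : E₁ × E₂ → ℝ≥0∞}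

/-- The contribution of `{y₃ = o₃}` to the exponent in the Laplace functional, at the function `F`
of the first two coordinates, of a Poisson process with mean measure `Λ`. -/
noncomputable def axisExponent (Λ : Measure (Punctured (o₁, o₂, o₃))) (F : E₁ × E₂ → ℝ≥0∞) :
    ℝ≥0∞ :=
  ∫⁻ y in {y | y.1.2.2 = o₃}, (1 - expNeg (F (y.1.1, y.1.2.1))) ∂Λ

/-- The function `y₃ ↦ -log ∫ exp (-F) dK(y₃)`, extended by `0` to `o₃`. -/
noncomputable def kernelExponent (K : Kernel (Punctured o₃) (E₁ × E₂)) (F : E₁ × E₂ → ℝ≥0∞) :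
    E₃ → ℝ≥0∞ :=
  Function.extend Subtype.val (fun y₃ => negLog (∫⁻ p, expNeg (F p) ∂(K y₃))) 0

lemma kernelExponent_base : kernelExponent K F o₃ = 0 :=
  Function.extend_apply' _ _ _ fun ⟨y₃, h⟩ => y₃.2 h

lemma expNeg_kernelExponent [IsMarkovKernel K] (y₃ : Punctured o₃) :
    expNeg (kernelExponent K F y₃) = ∫⁻ p, expNeg (F p) ∂(K y₃) := by
  rw [kernelExponent, Subtype.val_injective.extend_apply,
    expNeg_negLog (lintegral_expNeg_le_one F)]

variable [MeasurableSingletonClass E₃]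

lemma measurable_kernelExponent (hF : Measurable F) : Measurable (kernelExponent K F) := by
  refine measurableEmbedding_puncturedVal.measurable_extend (measurable_negLog.comp ?_)
    measurable_zero
  exact (measurable_expNeg.comp hF).lintegral_kernel

lemma IsDisintegration.lintegral_eq [SFinite (marginal₃ Λ)] (hK : IsDisintegration Λ K)
    {φ : Punctured (o₁, o₂, o₃) → ℝ≥0∞} (hφ : Measurable φ) :
    ∫⁻ y, φ y ∂Λ = ∫⁻ y in {y | y.1.2.2 = o₃}, φ y ∂Λ +
      ∫⁻ y₃, ∫⁻ p, φ (insertThird (y₃, p)) ∂(K y₃) ∂(marginal₃ Λ) := by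
  have := hK.1
  rw [← lintegral_add_compl φ measurableSet_third, (isDisintegration_iff.1 hK).2,
    lintegral_map hφ measurable_insertThird, Measure.lintegral_compProd (by fun_prop)]

theorem IsDisintegration.lintegral_one_sub_expNeg_add [SFinite (marginal₃ Λ)]
    (hK : IsDisintegration Λ K)
    (hΛ₃ : Λ {y | y.1.2.2 = o₃} = 0 ∨ Λ {y | y.1.2.2 = o₃} = ∞) (hF : Measurable F)
    {k : E₃ → ℝ≥0∞} (hk : Measurable k) (hk_base : k o₃ = 0)
    (hkK : ∀ᵐ y₃ : Punctured o₃ ∂(marginal₃ Λ), expNeg (k y₃.1) = ∫⁻ p, expNeg (F p) ∂(K y₃))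
    {f : E₃ → ℝ≥0∞} (hf : Measurable f) :
    ∫⁻ y, (1 - expNeg (F (y.1.1, y.1.2.1) + f y.1.2.2)) ∂Λ =
      axisExponent Λ F + ∫⁻ z, (1 - expNeg (k z + f z)) ∂(proj₃ Λ) := by
  have := hK.1
  have hfiber (G : Punctured (o₁, o₂, o₃) → ℝ≥0∞) :=
    setLIntegral_one_sub_expNeg_add measurableSet_third hΛ₃ G (G := fun y => f y.1.2.2)
      (c := f o₃) fun y hy => congrArg f hy
  have hk_fiber : ∫⁻ y in {y | y.1.2.2 = o₃}, (1 - expNeg (k y.1.2.2)) ∂Λ = 0 :=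
    setLIntegral_eq_zero measurableSet_third fun y hy => by
      simp [show y.1.2.2 = o₃ from hy, hk_base]
  have hkernel : ∫⁻ y₃ : Punctured o₃, ∫⁻ p, (1 - expNeg (F p + f y₃.1)) ∂(K y₃) ∂(marginal₃ Λ) =
      ∫⁻ y₃ : Punctured o₃, ∫⁻ _, (1 - expNeg (k y₃.1 + f y₃.1)) ∂(K y₃) ∂(marginal₃ Λ) := by
    refine lintegral_congr_ae (hkK.mono fun y₃ hy₃ => ?_)
    simp only
    rw [lintegral_one_sub_expNeg_add_of_isProbabilityMeasure hF, ← hy₃, ← expNeg_add,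
      lintegral_const, measure_univ, mul_one]
  rw [proj₃, lintegral_map (by fun_prop) measurable_coord₃, hK.lintegral_eq (by fun_prop),
    hK.lintegral_eq (by fun_prop), hfiber fun y => F (y.1.1, y.1.2.1),
    hfiber fun y => k y.1.2.2, hk_fiber, zero_add, axisExponent, add_assoc]
  exact congrArg _ (congrArg _ hkernel)

variable {Ω : Type*} [MeasurableSpace Ω] {μ : Measure Ω} {ξ : Ω → Measure (Punctured (o₁, o₂, o₃))}

/-- Since `{y₃ = o₃}` has mass `0` or `∞`, the number of points at `o₃` in the third projection is
almost surely constant, and conditioning on it does not affect the factor `axisExponent Λ F`. -/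
theorem HasPoissonLaplace.condLExp_expNeg_proj₃ [SFinite (marginal₃ Λ)]
    (hξ : HasPoissonLaplace ξ Λ μ)
    (hΛ₃ : Λ {y | y.1.2.2 = o₃} = 0 ∨ Λ {y | y.1.2.2 = o₃} = ∞) (hK : IsDisintegration Λ K)
    (hF : Measurable F) {k : E₃ → ℝ≥0∞} (hk : Measurable k) (hk_base : k o₃ = 0)
    (hkK : ∀ᵐ y₃ : Punctured o₃ ∂(marginal₃ Λ), expNeg (k y₃.1) = ∫⁻ p, expNeg (F p) ∂(K y₃)) :
    μ⁻[fun ω => expNeg (∫⁻ y, F (y.1.1, y.1.2.1) ∂(ξ ω))|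
        .comap (fun ω => proj₃ (ξ ω)) inferInstance] =ᵐ[μ]
      fun ω => expNeg (axisExponent Λ F + ∫⁻ z, k z ∂(proj₃ (ξ ω))) :=
  hξ.condLExp_expNeg_lintegral measurable_coord₃ (hF.comp measurable_coord₁₂) hk fun _ hf =>
    hK.lintegral_one_sub_expNeg_add hΛ₃ hF hk hk_base hkK hf

end Exponents

section KernelToCondIndep

variable {E₁ E₂ E₃ : Type*} [MeasurableSpace E₁] [MeasurableSpace E₂] [MeasurableSpace E₃]
  {o₁ : E₁} {o₂ : E₂} {o₃ : E₃}

@[fun_prop]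
lemma measurable_proj₁ : Measurable (proj₁ : Measure (Punctured (o₁, o₂, o₃)) → Measure E₁) :=
  Measure.measurable_map _ measurable_coord₁

@[fun_prop]
lemma measurable_proj₂ : Measurable (proj₂ : Measure (Punctured (o₁, o₂, o₃)) → Measure E₂) :=
  Measure.measurable_map _ measurable_coord₂

@[fun_prop]
lemma measurable_proj₃ : Measurable (proj₃ : Measure (Punctured (o₁, o₂, o₃)) → Measure E₃) :=
  Measure.measurable_map _ measurable_coord₃

lemma lintegral_expNeg_add_of_eq_prod {P : Measure (E₁ × E₂)} [SFinite P.snd]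
    (h : P = P.fst.prod P.snd) {f₁ : E₁ → ℝ≥0∞} {f₂ : E₂ → ℝ≥0∞} (hf₁ : Measurable f₁)
    (hf₂ : Measurable f₂) :
    ∫⁻ p, expNeg (f₁ p.1 + f₂ p.2) ∂P =
      (∫⁻ p, expNeg (f₁ p.1) ∂P) * ∫⁻ p, expNeg (f₂ p.2) ∂P := by
  have hf₁' : Measurable fun y => expNeg (f₁ y) := by fun_prop
  have hf₂' : Measurable fun y => expNeg (f₂ y) := by fun_prop
  rw [← lintegral_map hf₁' measurable_fst, ← lintegral_map hf₂' measurable_snd,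
    ← Measure.fst, ← Measure.snd, ← lintegral_prod_mul hf₁'.aemeasurable hf₂'.aemeasurable, ← h]
  simp only [expNeg_add]

variable [MeasurableSingletonClass E₃] {Λ : Measure (Punctured (o₁, o₂, o₃))}

lemma axisExponent_add [MeasurableSingletonClass E₁] [MeasurableSingletonClass E₂]
    (hΛ₁ : Λ {y | y.1.1 = o₁ ∧ y.1.2.2 = o₃} = 0 ∨ Λ {y | y.1.1 = o₁ ∧ y.1.2.2 = o₃} = ∞)
    (hΛ₂ : Λ {y | y.1.2.1 = o₂ ∧ y.1.2.2 = o₃} = 0 ∨ Λ {y | y.1.2.1 = o₂ ∧ y.1.2.2 = o₃} = ∞)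
    (hnull : Λ {y | y.1.1 ≠ o₁ ∧ y.1.2.1 ≠ o₂ ∧ y.1.2.2 = o₃} = 0)
    (f₁ : E₁ → ℝ≥0∞) (f₂ : E₂ → ℝ≥0∞) :
    axisExponent Λ (fun p => f₁ p.1 + f₂ p.2) =
      axisExponent Λ (fun p => f₁ p.1) + axisExponent Λ (fun p => f₂ p.2) := by
  have hfirst := setLIntegral_one_sub_expNeg_add measurableSet_second_third hΛ₂
    (fun y => f₁ y.1.1) (G := fun y => f₂ y.1.2.1) (c := f₂ o₂) fun y hy => congrArg f₂ hy.1
  have hsecond := setLIntegral_one_sub_expNeg_add measurableSet_first_third hΛ₁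
    (fun y => f₂ y.1.2.1) (G := fun y => f₁ y.1.1) (c := f₁ o₁) fun y hy => congrArg f₁ hy.1
  simp only [add_comm (f₂ _)] at hsecond
  rw [add_comm (∫⁻ _ in _, _ ∂_)] at hsecond
  simp only [axisExponent, restrict_third_eq_add hnull, lintegral_add_measure, hfirst, hsecond]
  exact add_add_add_comm _ _ _ _

variable {Ω : Type*} [MeasurableSpace Ω] {μ : Measure Ω} {ξ : Ω → Measure (Punctured (o₁, o₂, o₃))}
  {K : Kernel (Punctured o₃) (E₁ × E₂)}

theorem HasPoissonLaplace.condUncorrelated_expNeg_proj_iff [SFinite (marginal₃ Λ)]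
    (hξ : HasPoissonLaplace ξ Λ μ)
    (hΛ₃ : Λ {y | y.1.2.2 = o₃} = 0 ∨ Λ {y | y.1.2.2 = o₃} = ∞) (hK : IsDisintegration Λ K)
    {f₁ : E₁ → ℝ≥0∞} {f₂ : E₂ → ℝ≥0∞} (hf₁ : Measurable f₁) (hf₂ : Measurable f₂)
    {k : E₃ → ℝ≥0∞} (hk : Measurable k) (hk_base : k o₃ = 0)
    (hkK : ∀ᵐ y₃ : Punctured o₃ ∂(marginal₃ Λ),
      expNeg (k y₃.1) = ∫⁻ p, expNeg (f₁ p.1 + f₂ p.2) ∂(K y₃)) :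
    CondUncorrelated (.comap (fun ω => proj₃ (ξ ω)) inferInstance) μ
        (fun ω => expNeg (∫⁻ y, f₁ y ∂(proj₁ (ξ ω))))
        (fun ω => expNeg (∫⁻ y, f₂ y ∂(proj₂ (ξ ω)))) ↔
      ∀ᵐ ω ∂μ, axisExponent Λ (fun p => f₁ p.1 + f₂ p.2) + ∫⁻ z, k z ∂(proj₃ (ξ ω)) =
        axisExponent Λ (fun p => f₁ p.1) + axisExponent Λ (fun p => f₂ p.2) +
          ∫⁻ z, (kernelExponent K (fun p => f₁ p.1) z +
            kernelExponent K (fun p => f₂ p.2) z) ∂(proj₃ (ξ ω)) := by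
  have := hK.1
  have hF₁ : Measurable fun p : E₁ × E₂ => f₁ p.1 := by fun_prop
  have hF₂ : Measurable fun p : E₁ × E₂ => f₂ p.2 := by fun_prop
  have hk₁ := measurable_kernelExponent (K := K) hF₁
  have hk₂ := measurable_kernelExponent (K := K) hF₂
  have hcond := hξ.condLExp_expNeg_proj₃ hΛ₃ hK
    (F := fun p => f₁ p.1 + f₂ p.2) (by fun_prop) hk hk_base hkK
  have hcond₁ := hξ.condLExp_expNeg_proj₃ hΛ₃ hK hF₁ hk₁ kernelExponent_base
    (ae_of_all _ expNeg_kernelExponent)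
  have hcond₂ := hξ.condLExp_expNeg_proj₃ hΛ₃ hK hF₂ hk₂ kernelExponent_base
    (ae_of_all _ expNeg_kernelExponent)
  have hproj₁ (ω : Ω) : ∫⁻ y, f₁ y ∂(proj₁ (ξ ω)) = ∫⁻ y, f₁ y.1.1 ∂(ξ ω) :=
    lintegral_map hf₁ measurable_coord₁
  have hproj₂ (ω : Ω) : ∫⁻ y, f₂ y ∂(proj₂ (ξ ω)) = ∫⁻ y, f₂ y.1.2.1 ∂(ξ ω) :=
    lintegral_map hf₂ measurable_coord₂
  have hsum (ω : Ω) : ∫⁻ y, f₁ y.1.1 ∂(ξ ω) + ∫⁻ y, f₂ y.1.2.1 ∂(ξ ω) =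
      ∫⁻ y, (f₁ y.1.1 + f₂ y.1.2.1) ∂(ξ ω) := (lintegral_add_left (by fun_prop) _).symm
  simp only [CondUncorrelated, hproj₁, hproj₂, ← expNeg_add, hsum]
  refine Filter.eventually_congr ?_
  filter_upwards [hcond, hcond₁, hcond₂] with ω h h₁ h₂
  rw [h, h₁, h₂, ← expNeg_add, expNeg_injective.eq_iff, lintegral_add_left hk₁,
    add_add_add_comm]

theorem HasPoissonLaplace.condIndep_of_isDisintegration [MeasurableSingletonClass E₁]
    [MeasurableSingletonClass E₂] [SFinite (marginal₃ Λ)] (hξ : HasPoissonLaplace ξ Λ μ)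
    (hΛ₁ : Λ {y | y.1.1 = o₁ ∧ y.1.2.2 = o₃} = 0 ∨ Λ {y | y.1.1 = o₁ ∧ y.1.2.2 = o₃} = ∞)
    (hΛ₂ : Λ {y | y.1.2.1 = o₂ ∧ y.1.2.2 = o₃} = 0 ∨ Λ {y | y.1.2.1 = o₂ ∧ y.1.2.2 = o₃} = ∞)
    (hΛ₃ : Λ {y | y.1.2.2 = o₃} = 0 ∨ Λ {y | y.1.2.2 = o₃} = ∞)
    (hK : IsDisintegration Λ K)
    (hprod : ∀ᵐ y₃ ∂(marginal₃ Λ), K y₃ = (K.fst y₃).prod (K.snd y₃))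
    (hnull : Λ {y | y.1.1 ≠ o₁ ∧ y.1.2.1 ≠ o₂ ∧ y.1.2.2 = o₃} = 0) :
    CondIndep (fun ω => proj₁ (ξ ω)) (fun ω => proj₂ (ξ ω)) (fun ω => proj₃ (ξ ω)) μ := by
  have := hK.1
  have := hξ.isProbabilityMeasure
  have hξm := hξ.measurable
  refine condIndep_of_laplace (by fun_prop) (by fun_prop) (by fun_prop) fun f₁ f₂ hf₁ hf₂ => ?_
  have hk₁ := measurable_kernelExponent (K := K) (F := fun p => f₁ p.1) (by fun_prop)
  have hk₂ := measurable_kernelExponent (K := K) (F := fun p => f₂ p.2) (by fun_prop)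
  refine (hξ.condUncorrelated_expNeg_proj_iff hΛ₃ hK hf₁ hf₂ (hk₁.add hk₂)
    (by simp [kernelExponent_base]) (hprod.mono fun y₃ hy₃ => ?_)).2 (ae_of_all _ fun ω => ?_)
  · rw [Kernel.fst_apply, Kernel.snd_apply] at hy₃
    rw [Pi.add_apply, expNeg_add, expNeg_kernelExponent, expNeg_kernelExponent,
      lintegral_expNeg_add_of_eq_prod hy₃ hf₁ hf₂]
  · rw [axisExponent_add hΛ₁ hΛ₂ hnull]
    rfl

end KernelToCondIndep

section KernelIndep

variable {E : Type*} [MeasurableSpace E] {o : E} {L : ℕ → Set E}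

/-- The measurable sets that contain the complement of some `L h`, that is, whose complement is
localized. -/
def coboundedSets (L : ℕ → Set E) : Set (Set E) := {A | MeasurableSet A ∧ ∃ h, Aᶜ ⊆ L h}

lemma IsLocalizing.isPiSystem_coboundedSets (hL : IsLocalizing o L) :
    IsPiSystem (coboundedSets L) := by
  rintro A ⟨hA, h, hAL⟩ B ⟨hB, h', hBL⟩ -
  refine ⟨hA.inter hB, max h h', ?_⟩
  rw [Set.compl_inter]
  exact Set.union_subset (hAL.trans (hL.mono (le_max_left _ _)))
    (hBL.trans (hL.mono (le_max_right _ _)))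

lemma IsLocalizing.generateFrom_coboundedSets (hL : IsLocalizing o L) :
    MeasurableSpace.generateFrom (coboundedSets L) = ‹MeasurableSpace E› := by
  refine le_antisymm (MeasurableSpace.generateFrom_le fun A hA => hA.1) fun A hA => ?_
  have hbase : ⋂ h, (L h)ᶜ = {o} := by
    rw [← Set.compl_iUnion, hL.iUnion_eq]
    ext
    simp
  have hunion {B : Set E} (hB : MeasurableSet B) :
      MeasurableSet[.generateFrom (coboundedSets L)] (B ∪ {o}) := by
    rw [← hbase, Set.union_iInter]
    refine MeasurableSet.iInter fun h => MeasurableSpace.measurableSet_generateFrom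
      ⟨hB.union (hL.measurableSet h).compl, h, ?_⟩
    rw [Set.compl_union, compl_compl]
    exact Set.inter_subset_right
  by_cases ho : o ∈ A
  · simpa [ho] using hunion hA
  · have hsingleton := hunion MeasurableSet.empty
    rw [Set.empty_union] at hsingleton
    simpa [Set.union_sdiff_right, ho] using (hunion hA).diff hsingleton

variable {α β γ : Type*} [MeasurableSpace α] [MeasurableSpace β] [MeasurableSpace γ]

lemma ae_eq_prod_of_indepFun [MeasurableSpace.CountableOrCountablyGenerated α (β × γ)]
    {M : Measure α} [SFinite M] {K : Kernel α (β × γ)} [IsFiniteKernel K]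
    (h : Kernel.IndepFun Prod.fst Prod.snd K M) :
    ∀ᵐ a ∂M, K a = (K.fst a).prod (K.snd a) := by
  have h' : Kernel.IndepFun Prod.fst Prod.snd K M.toFinite := by
    simpa only [Kernel.indepFun_iff_measure_inter_preimage_eq_mul, ae_toFinite] using h
  rw [Kernel.indepFun_iff_compProd_map_prod_eq_compProd_prod_map_map measurable_fst
    measurable_snd] at h'
  have hK := Kernel.ae_eq_of_compProd_eq h'
  rw [ae_toFinite] at hK
  filter_upwards [hK] with a ha
  simpa [Kernel.prod_apply, Kernel.fst, Kernel.snd] using ha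

lemma indepFun_of_coboundedSets {oβ : β} {oγ : γ} {Lβ : ℕ → Set β} {Lγ : ℕ → Set γ}
    (hLβ : IsLocalizing oβ Lβ) (hLγ : IsLocalizing oγ Lγ) {M : Measure α} {K : Kernel α (β × γ)}
    [IsMarkovKernel K] (h : ∀ A ∈ coboundedSets Lβ, ∀ B ∈ coboundedSets Lγ,
      ∀ᵐ a ∂M, K a (Prod.fst ⁻¹' A ∩ Prod.snd ⁻¹' B) =
        K a (Prod.fst ⁻¹' A) * K a (Prod.snd ⁻¹' B)) :
    Kernel.IndepFun Prod.fst Prod.snd K M := by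
  refine Kernel.IndepSets.indep measurable_fst.comap_le measurable_snd.comap_le
    (hLβ.isPiSystem_coboundedSets.comap Prod.fst) (hLγ.isPiSystem_coboundedSets.comap Prod.snd)
    ?_ ?_ ?_
  · conv_lhs => rw [← hLβ.generateFrom_coboundedSets]
    exact MeasurableSpace.comap_generateFrom
  · conv_lhs => rw [← hLγ.generateFrom_coboundedSets]
    exact MeasurableSpace.comap_generateFrom
  · rintro _ _ ⟨A, hA, rfl⟩ ⟨B, hB, rfl⟩
    exact h A hA B hB

end KernelIndep

lemma one_sub_expNeg_add_le (a b : ℝ≥0∞) :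
    1 - expNeg (a + b) ≤ (1 - expNeg a) + (1 - expNeg b) := by
  rw [tsub_le_iff_right, expNeg_add]
  calc (1 : ℝ≥0∞) = (1 - expNeg a) + expNeg a * (1 - expNeg b + expNeg b) := by
        rw [tsub_add_cancel_of_le (expNeg_le_one b), mul_one,
          tsub_add_cancel_of_le (expNeg_le_one a)]
    _ ≤ (1 - expNeg a) + (1 * (1 - expNeg b) + expNeg a * expNeg b) := by
        rw [mul_add]
        gcongr
        exact expNeg_le_one a
    _ = _ := by rw [one_mul, add_assoc]

lemma measure_inter_eq_zero_of_measure_union_eq_add {α : Type*} [MeasurableSpace α] {M : Measure α}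
    {S T : Set α} (hT : MeasurableSet T) (hS_fin : M S ≠ ∞) (hT_fin : M T ≠ ∞)
    (h : M (S ∪ T) = M S + M T) : M (S ∩ T) = 0 :=
  (ENNReal.add_right_inj (ENNReal.add_ne_top.2 ⟨hS_fin, hT_fin⟩)).1
    (by rw [← h, measure_union_add_inter S hT, h, add_zero])

/-! ### From conditional independence to the kernel -/

section CondIndepToKernel

variable {E₁ E₂ E₃ : Type*} [MeasurableSpace E₁] [MeasurableSpace E₂] [MeasurableSpace E₃]
  {o₁ : E₁} {o₂ : E₂} {o₃ : E₃}
  {Λ : Measure (Punctured (o₁, o₂, o₃))} {K : Kernel (Punctured o₃) (E₁ × E₂)}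
  {Ω : Type*} [MeasurableSpace Ω] {μ : Measure Ω} {ξ : Ω → Measure (Punctured (o₁, o₂, o₃))}

lemma axisExponent_indicator_top {S : Type*} [MeasurableSpace S] {g : E₁ × E₂ → S}
    (hg : Measurable g) {D : Set S} (hD : MeasurableSet D) :
    axisExponent Λ (fun p => D.indicator (fun _ => ∞) (g p)) =
      Λ {y | g (y.1.1, y.1.2.1) ∈ D ∧ y.1.2.2 = o₃} :=
  (lintegral_one_sub_expNeg_indicator_top _ ((hg.comp measurable_coord₁₂) hD)).trans
    (Measure.restrict_apply ((hg.comp measurable_coord₁₂) hD))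

lemma lintegral_expNeg_indicator_top {α S : Type*} [MeasurableSpace α] [MeasurableSpace S]
    (P : Measure α) {g : α → S} (hg : Measurable g) {D : Set S} (hD : MeasurableSet D) :
    ∫⁻ p, expNeg (D.indicator (fun _ => ∞) (g p)) ∂P = P (g ⁻¹' Dᶜ) := by
  rw [← lintegral_indicator_one (hg hD.compl)]
  refine lintegral_congr fun p => ?_
  by_cases hp : g p ∈ D <;> simp [hp]

variable [MeasurableSingletonClass E₃]

lemma ae_marginal₃_of_ae_proj₃ {p : E₃ → Prop} (h : ∀ᵐ z ∂(proj₃ Λ), p z) :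
    ∀ᵐ y₃ : Punctured o₃ ∂(marginal₃ Λ), p y₃.1 := by
  rw [← measurableEmbedding_puncturedVal.ae_map_iff, marginal₃,
    measurableEmbedding_puncturedVal.map_comap]
  exact ae_restrict_of_ae h

theorem HasPoissonLaplace.exponents_add_of_condUncorrelated [SFinite (marginal₃ Λ)]
    (hξ : HasPoissonLaplace ξ Λ μ)
    (hΛ₃ : Λ {y | y.1.2.2 = o₃} = 0 ∨ Λ {y | y.1.2.2 = o₃} = ∞) (hK : IsDisintegration Λ K)
    {f₁ : E₁ → ℝ≥0∞} {f₂ : E₂ → ℝ≥0∞} (hf₁ : Measurable f₁) (hf₂ : Measurable f₂)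
    (hf₁_fin : ∫⁻ y, (1 - expNeg (f₁ y.1.1)) ∂Λ ≠ ∞)
    (hf₂_fin : ∫⁻ y, (1 - expNeg (f₂ y.1.2.1)) ∂Λ ≠ ∞)
    (h : CondUncorrelated (.comap (fun ω => proj₃ (ξ ω)) inferInstance) μ
      (fun ω => expNeg (∫⁻ y, f₁ y ∂(proj₁ (ξ ω))))
      (fun ω => expNeg (∫⁻ y, f₂ y ∂(proj₂ (ξ ω))))) :
    axisExponent Λ (fun p => f₁ p.1 + f₂ p.2) =
        axisExponent Λ (fun p => f₁ p.1) + axisExponent Λ (fun p => f₂ p.2) ∧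
      ∀ᵐ y₃ ∂(marginal₃ Λ), ∫⁻ p, expNeg (f₁ p.1 + f₂ p.2) ∂(K y₃) =
        (∫⁻ p, expNeg (f₁ p.1) ∂(K y₃)) * ∫⁻ p, expNeg (f₂ p.2) ∂(K y₃) := by
  have := hK.1
  have hexponents {F : E₁ × E₂ → ℝ≥0∞} (hF : Measurable F) :
      ∫⁻ y, (1 - expNeg (F (y.1.1, y.1.2.1))) ∂Λ =
        axisExponent Λ F + ∫⁻ z, (1 - expNeg (kernelExponent K F z)) ∂(proj₃ Λ) := by
    simpa using hK.lintegral_one_sub_expNeg_add hΛ₃ hF (measurable_kernelExponent hF)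
      kernelExponent_base (ae_of_all _ expNeg_kernelExponent) measurable_zero
  have hF₁ : Measurable fun p : E₁ × E₂ => f₁ p.1 := by fun_prop
  have hF₂ : Measurable fun p : E₁ × E₂ => f₂ p.2 := by fun_prop
  have hF : Measurable fun p : E₁ × E₂ => f₁ p.1 + f₂ p.2 := by fun_prop
  have hk₁ := measurable_kernelExponent (K := K) hF₁
  have hk₂ := measurable_kernelExponent (K := K) hF₂
  have hk := measurable_kernelExponent (K := K) hF
  have hf_fin : ∫⁻ y, (1 - expNeg (f₁ y.1.1 + f₂ y.1.2.1)) ∂Λ ≠ ∞ := by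
    refine ne_top_of_le_ne_top (ENNReal.add_ne_top.2 ⟨hf₁_fin, hf₂_fin⟩) ?_
    rw [← lintegral_add_left (by fun_prop)]
    exact lintegral_mono fun y => one_sub_expNeg_add_le _ _
  obtain ⟨hα₁, hκ₁⟩ := ENNReal.add_ne_top.1 (hexponents hF₁ ▸ hf₁_fin)
  obtain ⟨hα₂, hκ₂⟩ := ENNReal.add_ne_top.1 (hexponents hF₂ ▸ hf₂_fin)
  obtain ⟨-, hκ⟩ := ENNReal.add_ne_top.1 (hexponents hF ▸ hf_fin)
  have hκ_sum : ∫⁻ z, (1 - expNeg (kernelExponent K (fun p => f₁ p.1) z +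
      kernelExponent K (fun p => f₂ p.2) z)) ∂(proj₃ Λ) ≠ ∞ := by
    refine ne_top_of_le_ne_top (ENNReal.add_ne_top.2 ⟨hκ₁, hκ₂⟩) ?_
    rw [← lintegral_add_left (by fun_prop)]
    exact lintegral_mono fun z => one_sub_expNeg_add_le _ _
  obtain ⟨haxis, hkernel⟩ :=
    (hξ.map measurable_coord₃).eq_and_ae_eq_of_add_lintegral_ae_eq hk (hk₁.add hk₂) hκ hκ_sum
      (ENNReal.add_ne_top.2 ⟨hα₁, hα₂⟩)
      ((hξ.condUncorrelated_expNeg_proj_iff hΛ₃ hK hf₁ hf₂ hk kernelExponent_base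
        (ae_of_all _ expNeg_kernelExponent)).1 h)
  refine ⟨haxis, (ae_marginal₃_of_ae_proj₃ hkernel).mono fun y₃ hy₃ => ?_⟩
  rw [← expNeg_kernelExponent, ← expNeg_kernelExponent, ← expNeg_kernelExponent, hy₃,
    Pi.add_apply, expNeg_add]

theorem HasPoissonLaplace.kernel_inter_of_condIndep [SFinite (marginal₃ Λ)]
    (hξ : HasPoissonLaplace ξ Λ μ)
    (hΛ₃ : Λ {y | y.1.2.2 = o₃} = 0 ∨ Λ {y | y.1.2.2 = o₃} = ∞) (hK : IsDisintegration Λ K)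
    (h : CondIndep (fun ω => proj₁ (ξ ω)) (fun ω => proj₂ (ξ ω)) (fun ω => proj₃ (ξ ω)) μ)
    {B₁ : Set E₁} {B₂ : Set E₂} (hB₁ : MeasurableSet B₁) (hB₂ : MeasurableSet B₂)
    (hB₁_fin : Λ {y | y.1.1 ∈ B₁} ≠ ∞) (hB₂_fin : Λ {y | y.1.2.1 ∈ B₂} ≠ ∞) :
    Λ {y | y.1.1 ∈ B₁ ∧ y.1.2.1 ∈ B₂ ∧ y.1.2.2 = o₃} = 0 ∧
      ∀ᵐ y₃ ∂(marginal₃ Λ), K y₃ (Prod.fst ⁻¹' B₁ᶜ ∩ Prod.snd ⁻¹' B₂ᶜ) =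
        K y₃ (Prod.fst ⁻¹' B₁ᶜ) * K y₃ (Prod.snd ⁻¹' B₂ᶜ) := by
  have := hξ.isProbabilityMeasure
  have hξm := hξ.measurable
  have hunion (p : E₁ × E₂) : B₁.indicator (fun _ => (∞ : ℝ≥0∞)) p.1 +
      B₂.indicator (fun _ => ∞) p.2 = (B₁ᶜ ×ˢ B₂ᶜ)ᶜ.indicator (fun _ => ∞) p := by
    by_cases h₁ : p.1 ∈ B₁ <;> by_cases h₂ : p.2 ∈ B₂ <;> simp [h₁, h₂]
  have hcond := (condIndep_iff_condUncorrelated (by fun_prop) (by fun_prop)).1 h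
    {ν | ν B₁ = 0} {ν | ν B₂ = 0}
    (Measure.measurable_coe hB₁ (measurableSet_singleton 0))
    (Measure.measurable_coe hB₂ (measurableSet_singleton 0))
  obtain ⟨haxis, hkernel⟩ := hξ.exponents_add_of_condUncorrelated hΛ₃ hK
    (f₁ := B₁.indicator fun _ => ∞) (f₂ := B₂.indicator fun _ => ∞)
    (measurable_const.indicator hB₁) (measurable_const.indicator hB₂)
    (lintegral_one_sub_expNeg_indicator_top Λ (measurable_coord₁ hB₁) |>.trans_ne hB₁_fin)
    (lintegral_one_sub_expNeg_indicator_top Λ (measurable_coord₂ hB₂) |>.trans_ne hB₂_fin) <| by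
      simp only [expNeg_lintegral_indicator_top hB₁, expNeg_lintegral_indicator_top hB₂]
      exact hcond
  have hD : MeasurableSet (B₁ᶜ ×ˢ B₂ᶜ)ᶜ := (hB₁.compl.prod hB₂.compl).compl
  simp only [hunion] at haxis hkernel
  constructor
  · let S₁ : Set (Punctured (o₁, o₂, o₃)) := {y | y.1.1 ∈ B₁ ∧ y.1.2.2 = o₃}
    let S₂ : Set (Punctured (o₁, o₂, o₃)) := {y | y.1.2.1 ∈ B₂ ∧ y.1.2.2 = o₃}
    have hS : Λ (S₁ ∪ S₂) = Λ S₁ + Λ S₂ := by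
      rw [axisExponent_indicator_top measurable_id' hD,
        axisExponent_indicator_top measurable_fst hB₁,
        axisExponent_indicator_top measurable_snd hB₂] at haxis
      refine Eq.trans (congrArg Λ (Set.ext fun y => ?_)) haxis
      simp only [S₁, S₂, Set.mem_union, Set.mem_ofPred_eq, Set.mem_compl_iff, Set.mem_prod]
      tauto
    have hS₂ : MeasurableSet S₂ := (measurable_coord₂ hB₂).inter measurableSet_third
    have hnull : Λ (S₁ ∩ S₂) = 0 := measure_inter_eq_zero_of_measure_union_eq_add hS₂
      (ne_top_of_le_ne_top hB₁_fin (measure_mono fun y hy => hy.1))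
      (ne_top_of_le_ne_top hB₂_fin (measure_mono fun y hy => hy.1)) hS
    refine measure_mono_null (fun y hy => ?_) hnull
    exact ⟨⟨hy.1, hy.2.2⟩, hy.2.1, hy.2.2⟩
  · filter_upwards [hkernel] with y₃ hy₃
    rwa [lintegral_expNeg_indicator_top _ measurable_id' hD,
      lintegral_expNeg_indicator_top _ measurable_fst hB₁,
      lintegral_expNeg_indicator_top _ measurable_snd hB₂, compl_compl, Set.preimage_id',
      Set.prod_eq] at hy₃

theorem HasPoissonLaplace.ae_eq_prod_and_null_of_condIndep
    [MeasurableSpace.CountableOrCountablyGenerated (Punctured o₃) (E₁ × E₂)]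
    [SFinite (marginal₃ Λ)] (hξ : HasPoissonLaplace ξ Λ μ)
    {L₁ : ℕ → Set E₁} {L₂ : ℕ → Set E₂} (hL₁ : IsLocalizing o₁ L₁) (hL₂ : IsLocalizing o₂ L₂)
    (hΛL₁ : ∀ h, Λ {y | y.1.1 ∈ L₁ h} ≠ ∞) (hΛL₂ : ∀ h, Λ {y | y.1.2.1 ∈ L₂ h} ≠ ∞)
    (hΛ₃ : Λ {y | y.1.2.2 = o₃} = 0 ∨ Λ {y | y.1.2.2 = o₃} = ∞) (hK : IsDisintegration Λ K)
    (h : CondIndep (fun ω => proj₁ (ξ ω)) (fun ω => proj₂ (ξ ω)) (fun ω => proj₃ (ξ ω)) μ) :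
    (∀ᵐ y₃ ∂(marginal₃ Λ), K y₃ = (K.fst y₃).prod (K.snd y₃)) ∧
      Λ {y | y.1.1 ≠ o₁ ∧ y.1.2.1 ≠ o₂ ∧ y.1.2.2 = o₃} = 0 := by
  have := hK.1
  constructor
  · refine ae_eq_prod_of_indepFun (indepFun_of_coboundedSets hL₁ hL₂ ?_)
    rintro A ⟨hA, n, hAn⟩ B ⟨hB, m, hBm⟩
    simpa only [compl_compl] using (hξ.kernel_inter_of_condIndep hΛ₃ hK h hA.compl hB.compl
      (ne_top_of_le_ne_top (hΛL₁ n) (measure_mono fun y hy => hAn hy))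
      (ne_top_of_le_ne_top (hΛL₂ m) (measure_mono fun y hy => hBm hy))).2
  · refine measure_mono_null (t := ⋃ n, ⋃ m, {y | y.1.1 ∈ L₁ n ∧ y.1.2.1 ∈ L₂ m ∧ y.1.2.2 = o₃})
      ?_ (measure_iUnion_null fun n => measure_iUnion_null fun m =>
        (hξ.kernel_inter_of_condIndep hΛ₃ hK h (hL₁.measurableSet n) (hL₂.measurableSet m)
          (hΛL₁ n) (hΛL₂ m)).1)
    rintro y ⟨h₁, h₂, h₃⟩
    obtain ⟨n, hn⟩ := Set.mem_iUnion.1 (hL₁.iUnion_eq.superset h₁)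
    obtain ⟨m, hm⟩ := Set.mem_iUnion.1 (hL₂.iUnion_eq.superset h₂)
    exact Set.mem_iUnion₂.2 ⟨n, m, hn, hm, h₃⟩

end CondIndepToKernel

/-! ### Functional representation -/

section MarkKernel

variable {E E₃ : Type*} [MeasurableSpace E] [MeasurableSpace E₃] {o₃ : E₃}

/-- The kernel that maps `y₃` to the law of `h (y₃, s)` for a uniform variable `s`. -/
noncomputable def markKernel (o₃ : E₃) (h : E₃ × I → E) : Kernel (Punctured o₃) E :=
  (Kernel.id ×ₖ Kernel.const (Punctured o₃) (volume : Measure I)).map fun q => h (q.1.1, q.2)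

lemma isMarkovKernel_markKernel {h : E₃ × I → E} (hh : Measurable h) :
    IsMarkovKernel (markKernel o₃ h) :=
  Kernel.IsMarkovKernel.map _ (by fun_prop)

lemma markKernel_apply {h : E₃ × I → E} (hh : Measurable h) (y₃ : Punctured o₃) :
    markKernel o₃ h y₃ = (volume : Measure I).map fun s => h (y₃.1, s) := by
  rw [markKernel, Kernel.map_apply _ (by fun_prop), Kernel.prod_apply, Kernel.id_apply,
    Kernel.const_apply, Measure.dirac_prod, Measure.map_map (by fun_prop) (by fun_prop)]
  rfl

lemma exists_markKernel_eq [StandardBorelSpace E] [MeasurableSingletonClass E₃] (o : E)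
    (K : Kernel (Punctured o₃) E) [IsMarkovKernel K] :
    ∃ h : E₃ × I → E, Measurable h ∧ (∀ s, h (o₃, s) = o) ∧ markKernel o₃ h = K := by
  classical
  have : Nonempty E := ⟨o⟩
  obtain ⟨f, hf, hf_law⟩ := K.exists_measurable_map_eq_unitInterval
  let h (p : E₃ × I) : E := if hp : p ∈ {p : E₃ × I | p.1 = o₃} then o else f ⟨p.1, hp⟩ p.2
  have hh : Measurable h := by
    have hmk : Measurable fun p : ({p : E₃ × I | p.1 = o₃}ᶜ : Set (E₃ × I)) =>
        ((⟨p.1.1, p.2⟩, p.1.2) : Punctured o₃ × I) :=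
      (Measurable.subtype_mk measurable_subtype_coe.fst).prodMk measurable_subtype_coe.snd
    exact Measurable.dite (f := fun _ => o) measurable_const (hf.comp hmk)
      (measurable_fst (measurableSet_singleton o₃))
  refine ⟨h, hh, fun s => dif_pos rfl, Kernel.ext fun y₃ => ?_⟩
  rw [markKernel_apply hh, ← hf_law y₃]
  congr 1 with s
  exact dif_neg y₃.2

end MarkKernel

section Representation

lemma padd_base {E : Type*} (o x : E) : padd o x o = x := by
  simp [padd, eq_comm]

lemma measurable_padd {E : Type*} [MeasurableSpace E] [MeasurableSingletonClass E] (o : E) :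
    Measurable fun p : E × E => padd o p.1 p.2 := by
  classical
  exact Measurable.ite (measurable_fst (measurableSet_singleton o)) measurable_snd measurable_fst

variable {E₁ E₂ E₃ : Type*} {o₁ : E₁} {o₂ : E₂} {o₃ : E₃} {h₁ : E₃ × I → E₁} {h₂ : E₃ × I → E₂}

lemma representPoint_of_third_eq (hh₁ : ∀ s, h₁ (o₃, s) = o₁) (hh₂ : ∀ t, h₂ (o₃, t) = o₂)
    {y : Punctured (o₁, o₂, o₃)} (hy : y.1.2.2 = o₃) (s t : I) :
    representPoint h₁ h₂ hh₁ hh₂ y s t = y := by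
  simp only [representPoint, padd, hy, hh₁, hh₂, if_true]
  exact Subtype.ext (Prod.ext rfl (Prod.ext rfl hy.symm))

variable [MeasurableSpace E₁] [MeasurableSpace E₂] [MeasurableSpace E₃]

lemma representPoint_axis₃ (hh₁ : ∀ s, h₁ (o₃, s) = o₁) (hh₂ : ∀ t, h₂ (o₃, t) = o₂)
    (y₃ : Punctured o₃) (s t : I) :
    representPoint h₁ h₂ hh₁ hh₂ (axis₃ y₃) s t =
      insertThird (y₃, h₁ (y₃.1, s), h₂ (y₃.1, t)) :=
  Subtype.ext (Prod.ext (padd_base _ _) (Prod.ext (padd_base _ _) rfl))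

lemma measurable_representPoint [MeasurableSingletonClass E₁] [MeasurableSingletonClass E₂]
    (hh₁ : ∀ s, h₁ (o₃, s) = o₁) (hh₂ : ∀ t, h₂ (o₃, t) = o₂)
    (hh₁m : Measurable h₁) (hh₂m : Measurable h₂) :
    Measurable fun p : Punctured (o₁, o₂, o₃) × (I × I) =>
      representPoint h₁ h₂ hh₁ hh₂ p.1 p.2.1 p.2.2 :=
  Measurable.subtype_mk <|
    ((measurable_padd o₁).comp (Measurable.prodMk (by fun_prop) (by fun_prop))).prodMk <|
    ((measurable_padd o₂).comp (Measurable.prodMk (by fun_prop) (by fun_prop))).prodMk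
      (by fun_prop)

lemma lintegral_markKernel_prod (hh₁m : Measurable h₁) (hh₂m : Measurable h₂) (y₃ : Punctured o₃)
    {f : E₁ × E₂ → ℝ≥0∞} (hf : Measurable f) :
    ∫⁻ p, f p ∂((markKernel o₃ h₁ ×ₖ markKernel o₃ h₂) y₃) =
      ∫⁻ x, f (h₁ (y₃.1, x.1), h₂ (y₃.1, x.2)) ∂((volume : Measure I).prod volume) := by
  have := isMarkovKernel_markKernel (o₃ := o₃) hh₁m
  have := isMarkovKernel_markKernel (o₃ := o₃) hh₂m
  rw [Kernel.prod_apply, markKernel_apply hh₁m, markKernel_apply hh₂m,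
    Measure.map_prod_map _ _ (by fun_prop) (by fun_prop), lintegral_map hf (by fun_prop)]
  rfl

variable [MeasurableSingletonClass E₁] [MeasurableSingletonClass E₂] [MeasurableSingletonClass E₃]
  {Λ : Measure (Punctured (o₁, o₂, o₃))} [SFinite (marginal₃ Λ)]

theorem map_representPoint_extremalIndep_prod
    (hh₁ : ∀ s, h₁ (o₃, s) = o₁) (hh₂ : ∀ t, h₂ (o₃, t) = o₂)
    (hh₁m : Measurable h₁) (hh₂m : Measurable h₂) :
    ((extremalIndep Λ).prod (volume.prod volume)).map
        (fun p => representPoint h₁ h₂ hh₁ hh₂ p.1 p.2.1 p.2.2) =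
      axialMean Λ (markKernel o₃ h₁ ×ₖ markKernel o₃ h₂) := by
  have := isMarkovKernel_markKernel (o₃ := o₃) hh₁m
  have := isMarkovKernel_markKernel (o₃ := o₃) hh₂m
  have hrep := measurable_representPoint hh₁ hh₂ hh₁m hh₂m
  refine Measure.ext_of_lintegral _ fun φ hφ => ?_
  have hφ_rep : Measurable fun p : Punctured (o₁, o₂, o₃) × (I × I) =>
      φ (representPoint h₁ h₂ hh₁ hh₂ p.1 p.2.1 p.2.2) := hφ.comp hrep
  have hfixed {y : Punctured (o₁, o₂, o₃)} (hy : y.1.2.2 = o₃) :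
      ∫⁻ x : I × I, φ (representPoint h₁ h₂ hh₁ hh₂ y x.1 x.2) = φ y := by
    simp [representPoint_of_third_eq hh₁ hh₂ hy]
  rw [lintegral_map hφ hrep, lintegral_prod _ hφ_rep.aemeasurable, extremalIndep,
    axialMean]
  simp only [lintegral_add_measure]
  congr 1
  · congr 1
    · exact setLIntegral_congr_fun measurableSet_second_third fun y hy => hfixed hy.2
    · exact setLIntegral_congr_fun measurableSet_first_third fun y hy => hfixed hy.2
  · rw [lintegral_map hφ_rep.lintegral_prod_right' measurable_axis₃,
      lintegral_map hφ measurable_insertThird,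
      Measure.lintegral_compProd (f := fun q => φ (insertThird q)) (by fun_prop)]
    refine lintegral_congr fun y₃ => ?_
    rw [lintegral_markKernel_prod hh₁m hh₂m y₃ (f := fun p => φ (insertThird (y₃, p)))
      (by fun_prop)]
    simp only [representPoint_axis₃]

variable {Ω Ω' : Type*} [MeasurableSpace Ω] [MeasurableSpace Ω'] {μ : Measure Ω}
  {μ' : Measure Ω'} [IsProbabilityMeasure μ'] {ξ : Ω → Measure (Punctured (o₁, o₂, o₃))}
  {κ : Ω' → ℕ∞} {η : ℕ → Ω' → Punctured (o₁, o₂, o₃)} {θ₁ θ₂ : ℕ → Ω' → I}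

theorem IsPoissonEnumeration.hasPoissonLaplace_representPoint
    (hη : IsPoissonEnumeration κ η (extremalIndep Λ) μ')
    (hθ₁ : IsUniformSeq θ₁ μ') (hθ₂ : IsUniformSeq θ₂ μ')
    (hθ : IndepFun (fun ω i => θ₁ i ω) (fun ω i => θ₂ i ω) μ')
    (hηθ : IndepFun (fun ω => (κ ω, fun i => η i ω))
      (fun ω => (fun i => θ₁ i ω, fun i => θ₂ i ω)) μ')
    (hh₁ : ∀ s, h₁ (o₃, s) = o₁) (hh₂ : ∀ t, h₂ (o₃, t) = o₂)
    (hh₁m : Measurable h₁) (hh₂m : Measurable h₂) :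
    HasPoissonLaplace (fun ω => pointSum (κ ω) fun i =>
        representPoint h₁ h₂ hh₁ hh₂ (η i ω) (θ₁ i ω) (θ₂ i ω))
      (axialMean Λ (markKernel o₃ h₁ ×ₖ markKernel o₃ h₂)) μ' := by
  have hpair : iIndepFun (fun i ω => (θ₁ i ω, θ₂ i ω)) μ' :=
    iIndepFun_prodMk hθ₁.indep hθ₂.indep hθ₁.measurable hθ₂.measurable hθ
  have hpair_law (i : ℕ) : μ'.map (fun ω => (θ₁ i ω, θ₂ i ω)) = volume.prod volume := by
    have hθi : IndepFun (θ₁ i) (θ₂ i) μ' := hθ.comp (measurable_pi_apply i) (measurable_pi_apply i)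
    rw [hθi.map_prod_eq_prod_map_map (hθ₁.measurable i).aemeasurable
      (hθ₂.measurable i).aemeasurable, hθ₁.law, hθ₂.law]
  have hzip : Measurable fun (s : (ℕ → I) × (ℕ → I)) i => (s.1 i, s.2 i) := by fun_prop
  have hmarked := hη.hasPoissonLaplace_marked
    (fun i => (hθ₁.measurable i).prodMk (hθ₂.measurable i)) hpair_law hpair
    (hηθ.comp measurable_id hzip)
  have hrep := measurable_representPoint hh₁ hh₂ hh₁m hh₂m
  simpa only [map_pointSum _ _ hrep, map_representPoint_extremalIndep_prod hh₁ hh₂ hh₁m hh₂m]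
    using hmarked.map hrep

theorem HasPoissonLaplace.identDistrib_representPoint_iff (hξ : HasPoissonLaplace ξ Λ μ)
    (hη : IsPoissonEnumeration κ η (extremalIndep Λ) μ')
    (hθ₁ : IsUniformSeq θ₁ μ') (hθ₂ : IsUniformSeq θ₂ μ')
    (hθ : IndepFun (fun ω i => θ₁ i ω) (fun ω i => θ₂ i ω) μ')
    (hηθ : IndepFun (fun ω => (κ ω, fun i => η i ω))
      (fun ω => (fun i => θ₁ i ω, fun i => θ₂ i ω)) μ')
    (hh₁ : ∀ s, h₁ (o₃, s) = o₁) (hh₂ : ∀ t, h₂ (o₃, t) = o₂)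
    (hh₁m : Measurable h₁) (hh₂m : Measurable h₂) :
    IdentDistrib ξ (fun ω => pointSum (κ ω) fun i =>
        representPoint h₁ h₂ hh₁ hh₂ (η i ω) (θ₁ i ω) (θ₂ i ω)) μ μ' ↔
      IsDisintegration Λ (markKernel o₃ h₁ ×ₖ markKernel o₃ h₂) ∧
        Λ {y | y.1.1 ≠ o₁ ∧ y.1.2.1 ≠ o₂ ∧ y.1.2.2 = o₃} = 0 := by
  have := isMarkovKernel_markKernel (o₃ := o₃) hh₁m
  have := isMarkovKernel_markKernel (o₃ := o₃) hh₂m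
  rw [hξ.identDistrib_iff
    (hη.hasPoissonLaplace_representPoint hθ₁ hθ₂ hθ hηθ hh₁ hh₂ hh₁m hh₂m), eq_axialMean_iff]

end Representation

section Equivalence

variable {E₁ E₂ E₃ : Type*} [MeasurableSpace E₁] [MeasurableSpace E₂] [MeasurableSpace E₃]
  {o₁ : E₁} {o₂ : E₂} {o₃ : E₃} {Λ : Measure (Punctured (o₁, o₂, o₃))}
  {K : Kernel (Punctured o₃) (E₁ × E₂)}

lemma IsDisintegration.fst_prod_snd (hK : IsDisintegration Λ K)
    (hprod : ∀ᵐ y₃ ∂(marginal₃ Λ), K y₃ = (K.fst y₃).prod (K.snd y₃)) :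
    IsDisintegration Λ (K.fst ×ₖ K.snd) := by
  have := hK.1
  refine ⟨inferInstance, fun A hA => (hK.2 A hA).trans (lintegral_congr_ae ?_)⟩
  filter_upwards [hprod] with y₃ hy₃
  rw [Kernel.prod_apply, ← hy₃]

lemma measure_localized_first_ne_top {L₁ : ℕ → Set E₁} {L₂ : ℕ → Set E₂} {L₃ : ℕ → Set E₃}
    (hΛ : ∀ h, Λ (localizingProd L₁ L₂ L₃ h) < ∞) (h : ℕ) : Λ {y | y.1.1 ∈ L₁ h} ≠ ∞ :=
  ne_top_of_le_ne_top (hΛ h).ne (measure_mono fun _ => Or.inl)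

lemma measure_localized_second_ne_top {L₁ : ℕ → Set E₁} {L₂ : ℕ → Set E₂} {L₃ : ℕ → Set E₃}
    (hΛ : ∀ h, Λ (localizingProd L₁ L₂ L₃ h) < ∞) (h : ℕ) : Λ {y | y.1.2.1 ∈ L₂ h} ≠ ∞ :=
  ne_top_of_le_ne_top (hΛ h).ne (measure_mono fun _ hy => Or.inr (Or.inl hy))

end Equivalence

end PoissonCI

theorem mainTheorem2_general
    {E₁ E₂ E₃ : Type*} [MeasurableSpace E₁] [MeasurableSpace E₂] [MeasurableSpace E₃]
    [StandardBorelSpace E₁] [StandardBorelSpace E₂] [MeasurableSingletonClass E₃]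
    (o₁ : E₁) (o₂ : E₂) (o₃ : E₃)
    (L₁ : ℕ → Set E₁) (L₂ : ℕ → Set E₂) (L₃ : ℕ → Set E₃)
    (hL₁ : PoissonCI.IsLocalizing o₁ L₁) (hL₂ : PoissonCI.IsLocalizing o₂ L₂)
    (hL₃ : PoissonCI.IsLocalizing o₃ L₃)
    (Λ : Measure (PoissonCI.Punctured (o₁, o₂, o₃)))
    (hΛ_fin : ∀ h, Λ (PoissonCI.localizingProd L₁ L₂ L₃ h) < ∞)
    (hΛ₁ : Λ {y | y.1.1 = o₁ ∧ y.1.2.2 = o₃} = 0 ∨ Λ {y | y.1.1 = o₁ ∧ y.1.2.2 = o₃} = ∞)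
    (hΛ₂ : Λ {y | y.1.2.1 = o₂ ∧ y.1.2.2 = o₃} = 0 ∨ Λ {y | y.1.2.1 = o₂ ∧ y.1.2.2 = o₃} = ∞)
    (hΛ₃ : Λ {y | y.1.2.2 = o₃} = 0 ∨ Λ {y | y.1.2.2 = o₃} = ∞)
    {Ω : Type*} [MeasurableSpace Ω] (μ : Measure Ω) [IsProbabilityMeasure μ]
    (ξ : Ω → Measure (PoissonCI.Punctured (o₁, o₂, o₃)))
    (hξ : PoissonCI.IsPoissonProcess ξ Λ μ) :
    (∀ K : Kernel (PoissonCI.Punctured o₃) (E₁ × E₂), PoissonCI.IsDisintegration Λ K →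
      (PoissonCI.CondIndep (fun ω => PoissonCI.proj₁ (ξ ω)) (fun ω => PoissonCI.proj₂ (ξ ω))
          (fun ω => PoissonCI.proj₃ (ξ ω)) μ ↔
        (∀ᵐ y₃ ∂(PoissonCI.marginal₃ Λ), K y₃ = (K.fst y₃).prod (K.snd y₃)) ∧
          Λ {y | y.1.1 ≠ o₁ ∧ y.1.2.1 ≠ o₂ ∧ y.1.2.2 = o₃} = 0)) ∧
    (∀ {Ω' : Type*} [MeasurableSpace Ω'] (μ' : Measure Ω') [IsProbabilityMeasure μ']
      (κ : Ω' → ℕ∞) (η : ℕ → Ω' → PoissonCI.Punctured (o₁, o₂, o₃)) (θ₁ θ₂ : ℕ → Ω' → I),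
      PoissonCI.IsPoissonEnumeration κ η (PoissonCI.extremalIndep Λ) μ' →
      PoissonCI.IsUniformSeq θ₁ μ' → PoissonCI.IsUniformSeq θ₂ μ' →
      IndepFun (fun ω i => θ₁ i ω) (fun ω i => θ₂ i ω) μ' →
      IndepFun (fun ω => (κ ω, fun i => η i ω))
        (fun ω => (fun i => θ₁ i ω, fun i => θ₂ i ω)) μ' →
      (PoissonCI.CondIndep (fun ω => PoissonCI.proj₁ (ξ ω)) (fun ω => PoissonCI.proj₂ (ξ ω))
          (fun ω => PoissonCI.proj₃ (ξ ω)) μ ↔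
        ∃ (h₁ : E₃ × I → E₁) (h₂ : E₃ × I → E₂) (_ : Measurable h₁) (_ : Measurable h₂)
          (hh₁ : ∀ s, h₁ (o₃, s) = o₁) (hh₂ : ∀ t, h₂ (o₃, t) = o₂),
          IdentDistrib ξ
            (fun ω => PoissonCI.pointSum (κ ω) (fun i =>
              PoissonCI.representPoint h₁ h₂ hh₁ hh₂ (η i ω) (θ₁ i ω) (θ₂ i ω))) μ μ')) := by
  have := PoissonCI.sigmaFinite_marginal₃ hL₃ hΛ_fin
  have hξ_laplace := hξ.hasPoissonLaplace
  have hab (K : Kernel (PoissonCI.Punctured o₃) (E₁ × E₂)) (hK : PoissonCI.IsDisintegration Λ K) :=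
    Iff.intro
      (hξ_laplace.ae_eq_prod_and_null_of_condIndep hL₁ hL₂
        (PoissonCI.measure_localized_first_ne_top hΛ_fin)
        (PoissonCI.measure_localized_second_ne_top hΛ_fin) hΛ₃ hK)
      fun h => hξ_laplace.condIndep_of_isDisintegration hΛ₁ hΛ₂ hΛ₃ hK h.1 h.2
  refine ⟨hab, fun μ' _ κ η θ₁ θ₂ hη hθ₁ hθ₂ hθ hηθ => ⟨fun hcond => ?_, ?_⟩⟩
  · obtain ⟨K, hK⟩ := PoissonCI.exists_isDisintegration (Λ := Λ)
    obtain ⟨hprod, hnull⟩ := (hab K hK).1 hcond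
    have := hK.1
    obtain ⟨h₁, hh₁m, hh₁, hK₁⟩ := PoissonCI.exists_markKernel_eq o₁ K.fst
    obtain ⟨h₂, hh₂m, hh₂, hK₂⟩ := PoissonCI.exists_markKernel_eq o₂ K.snd
    refine ⟨h₁, h₂, hh₁m, hh₂m, hh₁, hh₂, (hξ_laplace.identDistrib_representPoint_iff hη hθ₁ hθ₂ hθ
      hηθ hh₁ hh₂ hh₁m hh₂m).2 ⟨?_, hnull⟩⟩
    exact hK₁ ▸ hK₂ ▸ hK.fst_prod_snd hprod
  · rintro ⟨h₁, h₂, hh₁m, hh₂m, hh₁, hh₂, hid⟩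
    obtain ⟨hK, hnull⟩ := (hξ_laplace.identDistrib_representPoint_iff hη hθ₁ hθ₂ hθ hηθ hh₁ hh₂
      hh₁m hh₂m).1 hid
    have := PoissonCI.isMarkovKernel_markKernel (o₃ := o₃) hh₁m
    have := PoissonCI.isMarkovKernel_markKernel (o₃ := o₃) hh₂m
    exact (hab _ hK).2 ⟨ae_of_all _ fun y₃ => by
      rw [Kernel.fst_prod, Kernel.snd_prod, Kernel.prod_apply], hnull⟩

theorem mainTheorem2
    {E₁ E₂ E₃ : Type*} [MeasurableSpace E₁] [MeasurableSpace E₂] [MeasurableSpace E₃]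
    [StandardBorelSpace E₁] [StandardBorelSpace E₂] [StandardBorelSpace E₃]
    (o₁ : E₁) (o₂ : E₂) (o₃ : E₃)
    (L₁ : ℕ → Set E₁) (L₂ : ℕ → Set E₂) (L₃ : ℕ → Set E₃)
    (hL₁ : PoissonCI.IsLocalizing o₁ L₁) (hL₂ : PoissonCI.IsLocalizing o₂ L₂)
    (hL₃ : PoissonCI.IsLocalizing o₃ L₃)
    (Λ : Measure (PoissonCI.Punctured (o₁, o₂, o₃)))
    (hΛ_fin : ∀ h, Λ (PoissonCI.localizingProd L₁ L₂ L₃ h) < ∞)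
    (hΛ_inf : Λ Set.univ = ∞)
    (hΛ₁ : Λ {y | y.1.1 = o₁ ∧ y.1.2.2 = o₃} = 0 ∨ Λ {y | y.1.1 = o₁ ∧ y.1.2.2 = o₃} = ∞)
    (hΛ₂ : Λ {y | y.1.2.1 = o₂ ∧ y.1.2.2 = o₃} = 0 ∨ Λ {y | y.1.2.1 = o₂ ∧ y.1.2.2 = o₃} = ∞)
    (hΛ₃ : Λ {y | y.1.2.2 = o₃} = 0 ∨ Λ {y | y.1.2.2 = o₃} = ∞)
    {Ω : Type*} [MeasurableSpace Ω] (μ : Measure Ω) [IsProbabilityMeasure μ]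
    (ξ : Ω → Measure (PoissonCI.Punctured (o₁, o₂, o₃)))
    (hξ : PoissonCI.IsPoissonProcess ξ Λ μ) :
    -- (a) ↔ (b), for every version `K` of the conditional kernel
    (∀ K : Kernel (PoissonCI.Punctured o₃) (E₁ × E₂), PoissonCI.IsDisintegration Λ K →
      (PoissonCI.CondIndep (fun ω => PoissonCI.proj₁ (ξ ω)) (fun ω => PoissonCI.proj₂ (ξ ω))
          (fun ω => PoissonCI.proj₃ (ξ ω)) μ ↔
        (∀ᵐ y₃ ∂(PoissonCI.marginal₃ Λ), K y₃ = (K.fst y₃).prod (K.snd y₃)) ∧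
          Λ {y | y.1.1 ≠ o₁ ∧ y.1.2.1 ≠ o₂ ∧ y.1.2.2 = o₃} = 0)) ∧
    -- (a) ↔ (c), for every enumerated Poisson process with the mean measure in question and
    -- every choice of the uniform randomizers
    (∀ {Ω' : Type*} [MeasurableSpace Ω'] (μ' : Measure Ω') [IsProbabilityMeasure μ']
      (κ : Ω' → ℕ∞) (η : ℕ → Ω' → PoissonCI.Punctured (o₁, o₂, o₃)) (θ₁ θ₂ : ℕ → Ω' → I),
      PoissonCI.IsPoissonEnumeration κ η (PoissonCI.extremalIndep Λ) μ' →
      PoissonCI.IsUniformSeq θ₁ μ' → PoissonCI.IsUniformSeq θ₂ μ' →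
      IndepFun (fun ω i => θ₁ i ω) (fun ω i => θ₂ i ω) μ' →
      IndepFun (fun ω => (κ ω, fun i => η i ω))
        (fun ω => (fun i => θ₁ i ω, fun i => θ₂ i ω)) μ' →
      (PoissonCI.CondIndep (fun ω => PoissonCI.proj₁ (ξ ω)) (fun ω => PoissonCI.proj₂ (ξ ω))
          (fun ω => PoissonCI.proj₃ (ξ ω)) μ ↔
        ∃ (h₁ : E₃ × I → E₁) (h₂ : E₃ × I → E₂) (_ : Measurable h₁) (_ : Measurable h₂)
          (hh₁ : ∀ s, h₁ (o₃, s) = o₁) (hh₂ : ∀ t, h₂ (o₃, t) = o₂),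
          IdentDistrib ξ
            (fun ω => PoissonCI.pointSum (κ ω) (fun i =>
              PoissonCI.representPoint h₁ h₂ hh₁ hh₂ (η i ω) (θ₁ i ω) (θ₂ i ω))) μ μ')) :=
  mainTheorem2_general o₁ o₂ o₃ L₁ L₂ L₃ hL₁ hL₂ hL₃ Λ hΛ_fin hΛ₁ hΛ₂ hΛ₃ μ ξ hξ
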